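/- **Setting.** Let $f:[0,1]\to\mathbb R^2$ be a simple closed curve ($f$ injective on $(0,1)$, $f(0)=f(1)$), differentiable on $[0,1]$ (one-sidedly at the end points) and parameterized proportionally to arclength, i.e. $\|f'\|$ is a positive constant. Put $\Gamma_f=f([0,1])$ and let $N(u)$ be the unit normal at $f(u)$, obtained by rotating $f'(u)/\|f'(u)\|$ by a right angle. The thickness $\Delta$ of $\Gamma_f$ is the infimum of the radii of all circles through three distinct points of $\Gamma_f$. Let $0<\sigma<\Delta$ and $S=\bigcup_{u}B(f(u),\sigma)$, where $B(x,r)$ is the closed disc; the two pieces of $\partial S$ are $\partial S_0=\{f(u)+s\sigma N(u):0\le u\le1\}$ and $\partial S_1=\{f(u)-s\sigma N(u):0\le u\le1\}$, where $s\in\{1,-1\}$ (either labelling is allowed). Let $d_H$ be the Hausdorff distance. Given nonempty compact sets $\widehat{\partial S}_0,\widehat{\partial S}_1\subset\mathbb R^2$, a medial estimator is a set $\hat\Gamma=\{\tfrac12(y+\hat y): y\in\widehat{\partial S}_0\}$, where $\hat y$ is a closest point to $y$ on $\widehat{\partial S}_1$ (ties broken arbitrarily). **Theorem.** 1. There is a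 constant $C>0$, depending only on $f$ and $\sigma$, such that whenever $d_H(\partial S_0,\widehat{\partial S}_0)\le\epsilon$ and $d_H(\partial S_1,\widehat{\partial S}_1)\le\epsilon$ with $\epsilon<(\Delta-\sigma)/2$, every medial estimator $\hat\Gamma$ satisfies: (i) for every $\hat\mu\in\hat\Gamma$ there is $x\in\Gamma_f$ with $\|\hat\mu-x\|\le2\epsilon$; (ii) for every $x\in\Gamma_f$ there is $\hat\mu\in\hat\Gamma$ with $\|\hat\mu-x\|\le C\sqrt\epsilon$; (iii) $d_H(\hat\Gamma,\Gamma_f)\le C\sqrt\epsilon$. 2. Let $Y_i=f(U_i)+\epsilon_i$, $i\ge1$, where the pairs $(U_i,\epsilon_i)$ are independent and identically distributed, $U_i$ and $\epsilon_i$ are independent, $U_i$ has a density on $[0,1]$ that is bounded and bounded away from zero, and $\epsilon_i$ has a bounded density $\phi$ on $\mathbb R^2$ that vanishes outside $B(0,\sigma)$, is continuous and positive in the interior of $B(0,\sigma)$, depends only on $\|x\|$ and is nonincreasing in $\|x\|$, and satisfies $\phi(x)\sim a(\sigma-\|x\|)^\beta$ as $\|x\|\uparrow\sigma$ for some $a>0$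 and $0\le\beta<\infty$. Put $\alpha=\beta+\tfrac12$, $r_n=(\log n/n)^{1/(2+\alpha)}$ and $\hat S=\hat S_n=\bigcup_{i=1}^nB(Y_i,Cr_n)$. (a) For every $C>\sqrt{2/(\chi\pi)}$ with $\chi=1/4$ there is a constant $K>0$ such that, with probability one, for all large $n$, $d_H(\Gamma_f,\hat\Gamma)\le K\sqrt{r_n}$ for every medial estimator $\hat\Gamma$ built from two disjoint simple closed curves $\widehat{\partial S}_0,\widehat{\partial S}_1$ (in either order) whose union is $\partial\hat S$. The same bound holds for every medial estimator built from the two parts of $\partial\hat S$ that consist of the points at least as close to $\partial S_0$ as to $\partial S_1$, and of the points at least as close to $\partial S_1$ as to $\partial S_0$; with probability one both parts are nonempty for all large $n$. (b) There is $C_0$, depending on $f$, $\sigma$ and the two densities, such that for every $C>C_0$, with probability one, for all large $n$, $\partial\hat S$ is the union of two disjoint simple closed curves. -/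

import Mathlib

open Set Filter Topology MeasureTheory ProbabilityTheory Metric

/-- The Euclidean plane. -/
abbrev Plane : Type := EuclideanSpace ℝ (Fin 2)

/-- The filament `Γ_f`, the image of `[0,1]` under `f`. Only the values of `f` on `[0,1]` matter. -/
def filament (f : ℝ → Plane) : Set Plane := f '' Icc 0 1

/-- A smooth simple closed filament, parameterized proportionally to arclength: differentiable on
`[0,1]` (one-sidedly at the end points) with derivative of constant nonzero norm, injective on
`(0,1)`, and with `f 0 = f 1`. -/
structure IsClosedFilament (f : ℝ → Plane) : Prop where
  differentiableOn : DifferentiableOn ℝ f (Icc 0 1)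
  constant_speed : ∃ ℓ : ℝ, 0 < ℓ ∧ ∀ u ∈ Icc (0 : ℝ) 1, ‖derivWithin f (Icc 0 1) u‖ = ℓ
  simple : InjOn f (Ioo 0 1)
  closed : f 0 = f 1

/-- The thickness `Δ`: the infimum of the radii of the circles that pass through three distinct
points of `Γ`. (Collinear triples lie on no circle and do not contribute. A closed filament has
non-collinear triples, so this is the infimum of a nonempty set of nonnegative reals.) -/
noncomputable def thickness (Γ : Set Plane) : ℝ :=
  sInf {r : ℝ | ∃ c : Plane, ∃ x ∈ Γ, ∃ y ∈ Γ, ∃ z ∈ Γ, x ≠ y ∧ y ≠ z ∧ x ≠ z ∧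
    dist x c = r ∧ dist y c = r ∧ dist z c = r}

/-- Rotation of the plane by a right angle. -/
def rot (v : Plane) : Plane := !₂[-v 1, v 0]

/-- The unit normal vector `N(u)` at `f u`. -/
noncomputable def unitNormal (f : ℝ → Plane) (u : ℝ) : Plane :=
  ‖derivWithin f (Icc 0 1) u‖⁻¹ • rot (derivWithin f (Icc 0 1) u)

/-- For `s = 1` and `s = -1`, the two pieces `{f(u) + s σ N(u)}` of the boundary of
`S = ⋃ u, B(f(u), σ)`. -/
noncomputable def boundaryCurve (f : ℝ → Plane) (σ s : ℝ) : Set Plane :=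
  (fun u => f u + (s * σ) • unitNormal f u) '' Icc 0 1

/-- `Γhat` is a medial estimator built from the boundary estimates `A₀`, `A₁`: the set of midpoints
of the segments that join each `y ∈ A₀` to a closest point `p y` of `A₁` (ties are broken
arbitrarily). -/
def IsMedialEstimator (A₀ A₁ Γhat : Set Plane) : Prop :=
  ∃ p : Plane → Plane, (∀ y ∈ A₀, p y ∈ A₁ ∧ dist y (p y) = infDist y A₁) ∧
    Γhat = (fun y => midpoint ℝ y (p y)) '' A₀

/-- `h` restricted to `[0,1]` is bounded and bounded away from zero. -/
structure IsPositionDensity (h : ℝ → ℝ) : Prop where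
  measurable : Measurable h
  bounds : ∃ c₁ c₂ : ℝ, 0 < c₁ ∧ ∀ u ∈ Icc (0 : ℝ) 1, c₁ ≤ h u ∧ h u ≤ c₂

/-- The law on `[0,1]` with density `h`. -/
noncomputable def positionLaw (h : ℝ → ℝ) : Measure ℝ :=
  (volume.restrict (Icc 0 1)).withDensity fun u => ENNReal.ofReal (h u)

/-- The conditions on the noise density: support `B(0,σ)`, boundedness, continuity and positivity
in the interior of the support (the uniform density on the disc is allowed), radial monotonicity
and symmetry, and `φ(x) ∼ a (σ - ‖x‖)^β` as `‖x‖` increases to `σ`. -/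
structure IsNoiseDensity (φ : Plane → ℝ) (σ β : ℝ) : Prop where
  measurable : Measurable φ
  nonneg : ∀ x, 0 ≤ φ x
  support : ∀ x, σ < ‖x‖ → φ x = 0
  bounded : ∃ b, ∀ x, φ x ≤ b
  continuousOn : ContinuousOn φ (ball 0 σ)
  pos : ∀ x ∈ ball (0 : Plane) σ, 0 < φ x
  nonincreasing : ∀ x y, ‖x‖ ≤ ‖y‖ → φ y ≤ φ x
  symmetric : ∀ x y, ‖x‖ = ‖y‖ → φ x = φ y
  boundary_behavior : 0 ≤ β ∧ ∃ a : ℝ, 0 < a ∧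
    Asymptotics.IsEquivalent (comap norm (𝓝[<] σ)) φ fun x : Plane => a * (σ - ‖x‖) ^ β

/-- The law on the plane with density `φ`. -/
noncomputable def noiseLaw (φ : Plane → ℝ) : Measure Plane :=
  volume.withDensity fun x => ENNReal.ofReal (φ x)

/-- The pairs `(U i, e i)` are independent, each with law `positionLaw h × noiseLaw φ`. -/
structure IsFilamentSample {Ω : Type*} [MeasurableSpace Ω] (P : Measure Ω)
    (h : ℝ → ℝ) (φ : Plane → ℝ) (U : ℕ → Ω → ℝ) (e : ℕ → Ω → Plane) : Prop where
  indep : iIndepFun (fun i ω => (U i ω, e i ω)) P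
  law : ∀ i, HasLaw (fun ω => (U i ω, e i ω)) ((positionLaw h).prod (noiseLaw φ)) P

/-- The rate `r_n = (log n / n)^(1/(2+α))` with `α = β + 1/2`. -/
noncomputable def rate (β : ℝ) (n : ℕ) : ℝ :=
  (Real.log n / n) ^ (1 / (2 + (β + 1 / 2)))

/-- The union of the closed balls of radius `r` around the first `n` of the points `Y`. -/
def unionOfBalls (Y : ℕ → Plane) (n : ℕ) (r : ℝ) : Set Plane :=
  ⋃ i ∈ Finset.range n, closedBall (Y i) r

/-- `A` is a simple closed curve. -/
def IsSimpleClosedCurve (A : Set Plane) : Prop :=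
  ∃ γ : ℝ → Plane, ContinuousOn γ (Icc 0 1) ∧ γ 0 = γ 1 ∧ InjOn γ (Ico 0 1) ∧
    γ '' Icc 0 1 = A

/-- `A₀` and `A₁` are two disjoint simple closed curves that together make up `D`. -/
structure IsTwoCurveSplitting (D A₀ A₁ : Set Plane) : Prop where
  curve₀ : IsSimpleClosedCurve A₀
  curve₁ : IsSimpleClosedCurve A₁
  disjoint : Disjoint A₀ A₁
  union : A₀ ∪ A₁ = D

/-- The part of an estimated boundary `D` on the side of the boundary curve with sign `s`: its
points that are at least as close to this curve as to the other one. -/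
noncomputable def boundaryPart (f : ℝ → Plane) (σ s : ℝ) (D : Set Plane) : Set Plane :=
  {x ∈ D | infDist x (boundaryCurve f σ s) ≤ infDist x (boundaryCurve f σ (-s))}

/-! The geometry rests on one inequality. A circle through three points has radius equal to the
product of the sides over `2 |cross|`, so thickness `Δ` bounds this product from below
(`ThreePointBound`). Letting two of the points merge along the curve gives `IsThickCurve.tangency`:
the two open discs of radius `Δ` tangent to the curve at `f u` contain no point of it. Hence the
tangent is continuous, also across the closing point, and a point at distance less than `Δ` has a
unique foot on the curve.

Next comes a global signed distance `g`. The points reached along `N` and those reached along `-N`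
form two closed connected sets that cover the plane. A lifting argument through the covering `ℝ →
Circle` shows that they meet only in the curve; this plays the role of the Jordan curve theorem. A
segment between opposite sides must then cross the curve, so `g` is 1-Lipschitz (`exists_isTube`).

For the medial estimator, `y` and its closest point `p y` have signed distances within `ε` of `σ`
and `-σ`, and they are at most `2σ + 2ε` apart; the Lipschitz property puts their midpoint at level
at most `2ε` in absolute value. The rate `√ε` in the other direction comes from two internally
tangent circles (`dist_antipode_sq_le`): almost minimal distance locates the opposite point only up
to a square root.

For the sample, an observation hits a ball of radius `ρ` at depth `η` inside the tube with
probability at least a constant times `ρ² η^(β+1/2)`; the `1/2` is the length `√η` of the arc of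
positions that can reach the ball. With `ρ` and `η` of order `r_n` this is a multiple of `log n /
n`, and a grid with Borel–Cantelli covers all points at that depth. The boundary of the union of
balls is then trapped in `||g| - σ| ≤ ε` with `ε` of order `r_n`, and the deterministic bound
applies. When the balls reach slightly beyond the `σ`-neighbourhood, each normal leaves their union
exactly once, so each side of the boundary is a graph over the filament. -/

/-! ### Plane vectors and the circumradius inequality. -/

/-- The determinant of two vectors of the plane. -/
def cross (p q : Plane) : ℝ := p 0 * q 1 - p 1 * q 0

lemma plane_inner (p q : Plane) : inner ℝ p q = p 0 * q 0 + p 1 * q 1 := by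
  simp [PiLp.inner_apply, Fin.sum_univ_two, mul_comm]

lemma plane_norm_sq (p : Plane) : ‖p‖ ^ 2 = p 0 ^ 2 + p 1 ^ 2 := by
  simp [EuclideanSpace.norm_sq_eq, Fin.sum_univ_two]

@[simp] lemma rot_zero_apply (p : Plane) : rot p 0 = -p 1 := by simp [rot]

@[simp] lemma rot_one_apply (p : Plane) : rot p 1 = p 0 := by simp [rot]

lemma plane_ext {p q : Plane} (h0 : p 0 = q 0) (h1 : p 1 = q 1) : p = q := by
  ext i; fin_cases i <;> assumption

lemma rot_smul (t : ℝ) (p : Plane) : rot (t • p) = t • rot p := by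
  apply plane_ext <;> simp

lemma norm_rot (p : Plane) : ‖rot p‖ = ‖p‖ := by
  have : ‖rot p‖ ^ 2 = ‖p‖ ^ 2 := by rw [plane_norm_sq, plane_norm_sq]; simp; ring
  exact (sq_eq_sq₀ (norm_nonneg _) (norm_nonneg _)).1 this

lemma continuous_rot : Continuous rot := by
  unfold rot
  fun_prop

lemma continuous_cross {X : Type*} [TopologicalSpace X] {p q : X → Plane} (hp : Continuous p)
    (hq : Continuous q) : Continuous fun x => cross (p x) (q x) := by
  unfold cross
  fun_prop

lemma inner_rot (p q : Plane) : inner ℝ (rot p) q = cross p q := by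
  rw [plane_inner, cross]; simp; ring

lemma cross_smul_left (t : ℝ) (p q : Plane) : cross (t • p) q = t * cross p q := by
  simp [cross]; ring

lemma cross_smul_right (t : ℝ) (p q : Plane) : cross p (t • q) = t * cross p q := by
  simp [cross]; ring

lemma inner_sq_add_cross_sq (p q : Plane) :
    (inner ℝ p q) ^ 2 + cross p q ^ 2 = ‖p‖ ^ 2 * ‖q‖ ^ 2 := by
  rw [plane_inner, cross, plane_norm_sq, plane_norm_sq]; ring

/-- Every circle through three points of `Γ` has radius at least `Δ`, expressed by the formula for
the circumradius. -/
def ThreePointBound (Γ : Set Plane) (Δ : ℝ) : Prop :=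
  ∀ a ∈ Γ, ∀ b ∈ Γ, ∀ c ∈ Γ, 2 * Δ * |cross (b - a) (c - a)| ≤ ‖b - a‖ * ‖c - b‖ * ‖c - a‖

/-- The circumradius of a triangle with sides `p`, `q`, `q - p` is `‖p‖ ‖q‖ ‖q - p‖ / (2 |cross p
q|)`, and it competes in the infimum; for collinear triples the left side vanishes. -/
lemma threePointBound_thickness (Γ : Set Plane) :
    ThreePointBound Γ (thickness Γ) := by
  intro a ha b hb c hc
  set p := b - a with hp
  set q := c - a with hq
  by_cases hD : cross p q = 0
  · rw [hD]; simp; positivity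
  -- The circumcentre relative to `a`: the solution, by Cramer's rule, of `2⟨o, p⟩ = ‖p‖²` and `2⟨o,
  -- q⟩ = ‖q‖²`.
  set o : Plane := !₂[(q 1 * ‖p‖ ^ 2 - p 1 * ‖q‖ ^ 2) / (2 * cross p q),
    (p 0 * ‖q‖ ^ 2 - q 0 * ‖p‖ ^ 2) / (2 * cross p q)] with ho
  have ho0 : o 0 * (2 * cross p q) = q 1 * ‖p‖ ^ 2 - p 1 * ‖q‖ ^ 2 := by
    simp [ho]; field_simp
  have ho1 : o 1 * (2 * cross p q) = p 0 * ‖q‖ ^ 2 - q 0 * ‖p‖ ^ 2 := by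
    simp [ho]; field_simp
  have hop : 2 * inner ℝ o p = ‖p‖ ^ 2 := by
    apply mul_right_cancel₀ hD
    rw [plane_inner]
    have : 2 * (o 0 * p 0 + o 1 * p 1) * cross p q =
      (o 0 * (2 * cross p q)) * p 0 + (o 1 * (2 * cross p q)) * p 1 := by ring
    rw [this, ho0, ho1, cross]; ring
  have hoq : 2 * inner ℝ o q = ‖q‖ ^ 2 := by
    apply mul_right_cancel₀ hD
    rw [plane_inner]
    have : 2 * (o 0 * q 0 + o 1 * q 1) * cross p q =
      (o 0 * (2 * cross p q)) * q 0 + (o 1 * (2 * cross p q)) * q 1 := by ring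
    rw [this, ho0, ho1, cross]; ring
  have hoo : ‖o‖ ^ 2 * (2 * cross p q) ^ 2 = (‖p‖ * ‖q - p‖ * ‖q‖) ^ 2 := by
    rw [plane_norm_sq o]
    have : (o 0 ^ 2 + o 1 ^ 2) * (2 * cross p q) ^ 2 =
      (o 0 * (2 * cross p q)) ^ 2 + (o 1 * (2 * cross p q)) ^ 2 := by ring
    rw [this, ho0, ho1, mul_pow, mul_pow, plane_norm_sq, plane_norm_sq, plane_norm_sq]
    simp; ring
  have hdist : ∀ v : Plane, 2 * inner ℝ o v = ‖v‖ ^ 2 → dist (a + v) (a + o) = ‖o‖ := by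
    intro v hv
    rw [dist_add_left, dist_eq_norm]
    apply (sq_eq_sq₀ (norm_nonneg _) (norm_nonneg _)).1
    rw [norm_sub_sq_real, real_inner_comm]; linarith
  have hle : thickness Γ ≤ ‖o‖ := by
    apply csInf_le
    · exact ⟨0, by rintro r ⟨c, x, -, y, -, z, -, -, -, -, h, -⟩; rw [← h]; exact dist_nonneg⟩
    · refine ⟨a + o, a, ha, b, hb, c, hc, ?_, ?_, ?_, ?_, ?_, ?_⟩
      · intro h; apply hD; simp [hp, h, cross]
      · intro h; apply hD; simp only [hp, hq, h, cross]; ring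
      · intro h; apply hD; simp [hq, h, cross]
      · simp
      · simpa [hp] using hdist p hop
      · simpa [hq] using hdist q hoq
  have hqp : c - b = q - p := by simp [hp, hq]
  rw [hqp]
  have h1 : ‖o‖ * (2 * |cross p q|) = ‖p‖ * ‖q - p‖ * ‖q‖ := by
    apply (sq_eq_sq₀ (by positivity) (by positivity)).1
    rw [← hoo, mul_pow, mul_pow, mul_pow, sq_abs]
  rw [← h1]
  nlinarith [mul_le_mul_of_nonneg_right hle (abs_nonneg (cross p q))]

/-- Two arcs that issue from the same point in the same direction `e`, inside a set that satisfies
a three-point bound, meet again. -/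
lemma ThreePointBound.arcs_meet {Γ : Set Plane} {Δ : ℝ} (hΓ : ThreePointBound Γ Δ) (hΔ : 0 < Δ)
    {p e : Plane} (hp : p ∈ Γ) (he : ‖e‖ = 1) {γ₁ γ₂ : ℝ → Plane} {η a : ℝ} (hη : 0 < η)
    (ha : 0 < a) (h₁ : γ₁ 0 = p) (h₂ : γ₂ 0 = p)
    (hΓ₁ : ∀ s ∈ Ioo 0 η, γ₁ s ∈ Γ) (hΓ₂ : ∀ s ∈ Ioo 0 η, γ₂ s ∈ Γ)
    (hc : ContinuousOn γ₂ (Ico 0 η))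
    (hd₁ : HasDerivWithinAt γ₁ (a • e) (Ioi 0) 0) (hd₂ : HasDerivWithinAt γ₂ (a • e) (Ioi 0) 0) :
    ∃ s ∈ Ioo 0 η, ∃ t ∈ Ioo 0 η, γ₁ s = γ₂ t := by
  have key : ∀ γ : ℝ → Plane, γ 0 = p → HasDerivWithinAt γ (a • e) (Ioi 0) 0 →
      ∀ᶠ s in 𝓝[>] (0 : ℝ), 0 < inner ℝ e (γ s - p) ∧ ‖γ s - p‖ ≤ 2 * inner ℝ e (γ s - p) := by
    intro γ h0 hd
    have hs := hasDerivWithinAt_iff_tendsto_slope.1 hd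
    have hI : Ioi (0 : ℝ) \ {0} = Ioi 0 := by simp
    rw [hI] at hs
    have hs1 : Tendsto (fun s => inner ℝ e (slope γ 0 s)) (𝓝[>] 0) (𝓝 (inner ℝ e (a • e))) :=
      tendsto_const_nhds.inner hs
    have e1 : inner ℝ e (a • e) = a := by
      rw [inner_smul_right, real_inner_self_eq_norm_sq, he]; simp
    rw [e1] at hs1
    have hs2 := hs.norm
    have e2 : ‖a • e‖ = a := by rw [norm_smul, he, Real.norm_of_nonneg ha.le, mul_one]
    rw [e2] at hs2
    -- The speed and its component along `e` both tend to `a`; the factors `5/4` and `3/4` have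
    -- ratio `5/3 < 2`.
    filter_upwards [hs1.eventually (lt_mem_nhds (show 3 / 4 * a < a by linarith)),
      hs2.eventually (gt_mem_nhds (show a < 5 / 4 * a by linarith)), self_mem_nhdsWithin]
      with s h1 h2 h3
    have hs0 : (0 : ℝ) < s := h3
    rw [slope_def_module, h0, sub_zero, inner_smul_right] at h1
    rw [slope_def_module, h0, sub_zero, norm_smul, norm_inv, Real.norm_of_nonneg hs0.le] at h2
    rw [inv_mul_eq_div, lt_div_iff₀ hs0] at h1
    rw [inv_mul_eq_div, div_lt_iff₀ hs0] at h2
    have : 0 < a * s := by positivity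
    constructor <;> linarith
  have hmem : ∀ᶠ s in 𝓝[>] (0 : ℝ), s ∈ Ioo 0 η := Ioo_mem_nhdsGT hη
  obtain ⟨δ, hδ, hδ'⟩ := (mem_nhdsGT_iff_exists_Ioo_subset).1 ((key γ₂ h₂ hd₂).and hmem)
  have hδ0 : (0 : ℝ) < δ := hδ
  set t₀ := δ / 2
  have ht₀ : t₀ ∈ Ioo 0 δ := ⟨by positivity, by simp only [t₀]; linarith⟩
  obtain ⟨⟨hx₀, -⟩, ht₀η⟩ := hδ' ht₀
  have htend : Tendsto (fun s => inner ℝ e (γ₁ s - p)) (𝓝[>] 0) (𝓝 0) := by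
    have : Tendsto γ₁ (𝓝[>] 0) (𝓝 p) := by
      rw [← h₁]; exact hd₁.continuousWithinAt
    have h2 := (tendsto_const_nhds (x := e)).inner (𝕜 := ℝ) (this.sub_const p)
    simpa using h2
  -- Choose a point of the first arc so low that the second arc also reaches its height along `e`,
  -- and below height `Δ / 2`.
  obtain ⟨s, ⟨hs1, hs2⟩, hs3, hs4, hs5⟩ := ((key γ₁ h₁ hd₁).and (hmem.and
    ((htend.eventually (gt_mem_nhds hx₀)).and
      (htend.eventually (gt_mem_nhds (show 0 < Δ / 2 by linarith)))))).exists
  have hcont : ContinuousOn (fun t => inner ℝ e (γ₂ t - p)) (Icc 0 t₀) :=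
    continuousOn_const.inner ((hc.mono (fun t ht => ⟨ht.1, ht.2.trans_lt ht₀η.2⟩)).sub
      continuousOn_const)
  obtain ⟨t, ht, hte⟩ := intermediate_value_Ioo (ht₀.1.le) hcont
    (show inner ℝ e (γ₁ s - p) ∈ Ioo _ _ from ⟨by simpa [h₂] using hs1, hs4⟩)
  obtain ⟨⟨-, ht2⟩, ht3⟩ := hδ' ⟨ht.1, ht.2.trans ht₀.2⟩
  refine ⟨s, hs3, t, ht3, ?_⟩
  -- Two distinct points at the same height `x` form with `p` a triangle with `|cross| = x ‖Q - P‖`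
  -- and two sides at most `2x`. The three-point bound then forces `Δ ≤ 2x`, against `x < Δ / 2`.
  by_contra hne
  have h3 := hΓ p hp (γ₁ s) (hΓ₁ s hs3) (γ₂ t) (hΓ₂ t ht3)
  set P := γ₁ s - p with hP
  set Q := γ₂ t - p with hQ
  have hPQ : γ₂ t - γ₁ s = Q - P := by simp [hP, hQ]
  rw [hPQ] at h3
  have hte' : inner ℝ e Q = inner ℝ e P := hte
  have hQP : 0 < ‖Q - P‖ := by
    rw [norm_pos_iff, ← hPQ, sub_ne_zero]; exact fun h => hne h.symm
  have hin : inner ℝ e (Q - P) = 0 := by rw [inner_sub_right, hte', sub_self]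
  have hcr : cross P Q ^ 2 = (inner ℝ e P) ^ 2 * ‖Q - P‖ ^ 2 := by
    have hw := inner_sq_add_cross_sq e (Q - P)
    rw [hin, he] at hw
    have hc1 : cross P Q = inner ℝ e P * cross e (Q - P) := by
      rw [plane_inner] at hin ⊢
      have hee := plane_norm_sq e
      rw [he] at hee
      simp only [cross, PiLp.sub_apply] at hin ⊢
      linear_combination (P 0 * Q 1 - P 1 * Q 0) * hee - (e 0 * P 1 - e 1 * P 0) * hin
    rw [hc1, mul_pow]
    have : cross e (Q - P) ^ 2 = ‖Q - P‖ ^ 2 := by linarith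
    rw [this]
  have hab : |cross P Q| = inner ℝ e P * ‖Q - P‖ := by
    apply (sq_eq_sq₀ (abs_nonneg _) (by positivity)).1
    rw [sq_abs, hcr, mul_pow]
  rw [hab] at h3
  rw [hte'] at ht2
  have h4 : ‖P‖ * ‖Q - P‖ * ‖Q‖ ≤ (2 * inner ℝ e P) * ‖Q - P‖ * (2 * inner ℝ e P) := by
    gcongr
  have h5 : 0 < inner ℝ e P * ‖Q - P‖ := by positivity
  nlinarith

/-! ### Regularity of a curve of positive thickness. -/

/-- `f` is a curve on `[0,1]` with speed `ℓ > 0` and unit tangent `T`, whose image satisfies a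
three-point bound. -/
structure IsThickCurve (f T : ℝ → Plane) (ℓ Δ : ℝ) : Prop where
  speed_pos : 0 < ℓ
  thickness_pos : 0 < Δ
  hasDeriv : ∀ u ∈ Icc (0 : ℝ) 1, HasDerivWithinAt f (ℓ • T u) (Icc 0 1) u
  norm_tangent : ∀ u ∈ Icc (0 : ℝ) 1, ‖T u‖ = 1
  bound : ThreePointBound (filament f) Δ
  simple : InjOn f (Ioo 0 1)
  closed : f 0 = f 1

namespace IsThickCurve

variable {f T : ℝ → Plane} {ℓ Δ : ℝ}

lemma continuousOn (h : IsThickCurve f T ℓ Δ) : ContinuousOn f (Icc 0 1) :=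
  fun u hu => (h.hasDeriv u hu).continuousWithinAt

lemma norm_sub_le (h : IsThickCurve f T ℓ Δ) {u v : ℝ} (hu : u ∈ Icc (0 : ℝ) 1)
    (hv : v ∈ Icc (0 : ℝ) 1) : ‖f v - f u‖ ≤ ℓ * |v - u| := by
  refine (convex_Icc (0 : ℝ) 1).norm_image_sub_le_of_norm_hasDerivWithin_le h.hasDeriv
    (fun x hx => ?_) hu hv
  rw [norm_smul, h.norm_tangent x hx, Real.norm_of_nonneg h.speed_pos.le, mul_one]

lemma nhdsWithin_neBot {u : ℝ} (hu : u ∈ Icc (0 : ℝ) 1) : (𝓝[Icc 0 1 \ {u}] u).NeBot :=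
  accPt_principal_iff_nhdsWithin.1 (uniqueDiffOn_Icc_zero_one u hu).accPt

/-- Divide the three-point bound for `f u`, `f v`, `c` by `|v - u|` and let `v → u`. Geometrically,
the open discs of radius `Δ` tangent at `f u` miss the curve. -/
lemma tangency (h : IsThickCurve f T ℓ Δ) {u : ℝ} (hu : u ∈ Icc (0 : ℝ) 1) {c : Plane}
    (hc : c ∈ filament f) : 2 * Δ * |cross (T u) (c - f u)| ≤ ‖c - f u‖ ^ 2 := by
  have hne := nhdsWithin_neBot hu
  have hs := hasDerivWithinAt_iff_tendsto_slope.1 (h.hasDeriv u hu)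
  have hcont : Tendsto f (𝓝[Icc 0 1 \ {u}] u) (𝓝 (f u)) :=
    (h.hasDeriv u hu).continuousWithinAt.mono_left (nhdsWithin_mono _ sdiff_subset)
  have hl : Tendsto (fun v => 2 * Δ * |cross (slope f u v) (c - f u)|) (𝓝[Icc 0 1 \ {u}] u)
      (𝓝 (2 * Δ * |cross (ℓ • T u) (c - f u)|)) := by
    have : Continuous fun w : Plane => 2 * Δ * |cross w (c - f u)| :=
      continuous_const.mul (continuous_cross continuous_id continuous_const).abs
    exact (this.tendsto _).comp hs
  have hr : Tendsto (fun v => ‖slope f u v‖ * ‖c - f v‖ * ‖c - f u‖) (𝓝[Icc 0 1 \ {u}] u)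
      (𝓝 (‖ℓ • T u‖ * ‖c - f u‖ * ‖c - f u‖)) :=
    (hs.norm.mul (hcont.const_sub c).norm).mul_const _
  have hle := le_of_tendsto_of_tendsto hl hr (by
    filter_upwards [self_mem_nhdsWithin] with v hv
    have h3 := h.bound (f u) ⟨u, hu, rfl⟩ (f v) ⟨v, hv.1, rfl⟩ c hc
    rw [slope_def_module, cross_smul_left, norm_smul, abs_mul, Real.norm_eq_abs]
    have := mul_le_mul_of_nonneg_left h3 (abs_nonneg (v - u)⁻¹)
    nlinarith)
  have hℓ := h.speed_pos
  rw [cross_smul_left, norm_smul, h.norm_tangent u hu, abs_mul, Real.norm_eq_abs,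
    abs_of_pos hℓ] at hle
  have : ℓ * (2 * Δ * |cross (T u) (c - f u)|) ≤ ℓ * ‖c - f u‖ ^ 2 := by nlinarith
  exact le_of_mul_le_mul_left this hℓ

/-- By tangency at `u`, the curve near parameter `v` deviates only quadratically from the tangent
line at `f u = f v`; dividing by `|w - v|` removes the deviation in the limit. -/
lemma cross_tangent_eq_zero (h : IsThickCurve f T ℓ Δ) {u v : ℝ} (hu : u ∈ Icc (0 : ℝ) 1)
    (hv : v ∈ Icc (0 : ℝ) 1) (huv : f u = f v) : cross (T u) (T v) = 0 := by
  have hne := nhdsWithin_neBot hv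
  have hs := hasDerivWithinAt_iff_tendsto_slope.1 (h.hasDeriv v hv)
  have hcont : Tendsto f (𝓝[Icc 0 1 \ {v}] v) (𝓝 (f v)) :=
    (h.hasDeriv v hv).continuousWithinAt.mono_left (nhdsWithin_mono _ sdiff_subset)
  have hl : Tendsto (fun w => 2 * Δ * |cross (T u) (slope f v w)|) (𝓝[Icc 0 1 \ {v}] v)
      (𝓝 (2 * Δ * |cross (T u) (ℓ • T v)|)) := by
    have : Continuous fun w : Plane => 2 * Δ * |cross (T u) w| :=
      continuous_const.mul (continuous_cross continuous_const continuous_id).abs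
    exact (this.tendsto _).comp hs
  have hr : Tendsto (fun w => ‖slope f v w‖ * ‖f w - f v‖) (𝓝[Icc 0 1 \ {v}] v)
      (𝓝 (‖ℓ • T v‖ * ‖f v - f v‖)) :=
    hs.norm.mul (hcont.sub_const _).norm
  have hle := le_of_tendsto_of_tendsto hl hr (by
    filter_upwards [self_mem_nhdsWithin] with w hw
    have h3 := h.tangency hu ⟨w, hw.1, rfl⟩
    rw [huv] at h3
    rw [slope_def_module, cross_smul_right, norm_smul, abs_mul, Real.norm_eq_abs]
    have := mul_le_mul_of_nonneg_left h3 (abs_nonneg (w - v)⁻¹)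
    nlinarith)
  have hℓ := h.speed_pos
  have hΔ := h.thickness_pos
  rw [sub_self, norm_zero, mul_zero, cross_smul_right, abs_mul] at hle
  have : 0 < 2 * Δ * |ℓ| := by positivity
  have h0 : |cross (T u) (T v)| ≤ 0 := by
    by_contra hc; push Not at hc; nlinarith
  exact abs_eq_zero.1 (le_antisymm h0 (abs_nonneg _))

lemma tangent_eq_or_eq_neg (h : IsThickCurve f T ℓ Δ) {u v : ℝ} (hu : u ∈ Icc (0 : ℝ) 1)
    (hv : v ∈ Icc (0 : ℝ) 1) (huv : f u = f v) : T v = T u ∨ T v = -T u := by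
  have h0 := h.cross_tangent_eq_zero hu hv huv
  have h1 := inner_sq_add_cross_sq (T u) (T v)
  have hnu := h.norm_tangent u hu
  have hnv := h.norm_tangent v hv
  rw [h0, hnu, hnv] at h1
  have h2 : (inner ℝ (T u) (T v) - 1) * (inner ℝ (T u) (T v) + 1) = 0 := by linarith
  rcases mul_eq_zero.1 h2 with h3 | h3
  · left
    rw [← sub_eq_zero, ← norm_eq_zero, ← sq_eq_zero_iff, norm_sub_sq_real, real_inner_comm, hnu, hnv]
    linarith
  · right
    rw [← sub_eq_zero, sub_neg_eq_add, ← norm_eq_zero, ← sq_eq_zero_iff, norm_add_sq_real,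
      real_inner_comm, hnu, hnv]
    linarith

lemma hasDerivWithinAt_Ioi (h : IsThickCurve f T ℓ Δ) {u : ℝ} (hu : u ∈ Ico (0 : ℝ) 1) :
    HasDerivWithinAt (fun s => f (u + s)) (ℓ • T u) (Ioi 0) 0 := by
  have h1 : HasDerivWithinAt f (ℓ • T u) (Ioi u) u :=
    ((h.hasDeriv u ⟨hu.1, hu.2.le⟩).mono_of_mem_nhdsWithin (Icc_mem_nhdsGT_of_mem hu))
  have h2 : HasDerivWithinAt (fun s : ℝ => u + s) 1 (Ioi 0) 0 :=
    ((hasDerivAt_id (0 : ℝ)).const_add u).hasDerivWithinAt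
  have := h1.scomp_of_eq (0 : ℝ) h2 (fun s (hs : 0 < s) => show u < u + s by linarith) (by simp)
  simpa [Function.comp_def] using this

lemma hasDerivWithinAt_Ioi_reverse (h : IsThickCurve f T ℓ Δ) {u : ℝ} (hu : u ∈ Ioc (0 : ℝ) 1) :
    HasDerivWithinAt (fun s => f (u - s)) (-(ℓ • T u)) (Ioi 0) 0 := by
  have h1 : HasDerivWithinAt f (ℓ • T u) (Iio u) u :=
    ((h.hasDeriv u ⟨hu.1.le, hu.2⟩).mono_of_mem_nhdsWithin (Icc_mem_nhdsLT_of_mem hu))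
  have h2 : HasDerivWithinAt (fun s : ℝ => u - s) (-1) (Ioi 0) 0 :=
    ((hasDerivAt_id (0 : ℝ)).const_sub u).hasDerivWithinAt
  have := h1.scomp_of_eq (0 : ℝ) h2 (fun s (hs : 0 < s) => show u - s < u by linarith) (by simp)
  simpa [Function.comp_def] using this

/-- Opposite tangents would make a cusp: the initial arc and the reversed final arc would leave `f
0` in the same direction and meet again, against injectivity on the open interval. -/
lemma tangent_closed (h : IsThickCurve f T ℓ Δ) : T 1 = T 0 := by
  have h0 : (0 : ℝ) ∈ Icc (0 : ℝ) 1 := by simp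
  have h1 : (1 : ℝ) ∈ Icc (0 : ℝ) 1 := by simp
  rcases h.tangent_eq_or_eq_neg h0 h1 h.closed with h2 | h2
  · exact h2
  exfalso
  obtain ⟨s, hs, t, ht, hst⟩ := h.bound.arcs_meet h.thickness_pos (p := f 0) (e := T 0)
    ⟨0, h0, rfl⟩ (h.norm_tangent 0 h0) (γ₁ := fun s => f (0 + s)) (γ₂ := fun s => f (1 - s))
    (η := 1 / 2) (by norm_num) h.speed_pos (by simp) (by simp [h.closed])
    (fun s hs => ⟨0 + s, ⟨by linarith [hs.1], by linarith [hs.2]⟩, rfl⟩)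
    (fun s hs => ⟨1 - s, ⟨by linarith [hs.2], by linarith [hs.1]⟩, rfl⟩)
    (h.continuousOn.comp (by fun_prop) (fun s hs => ⟨by linarith [hs.2], by linarith [hs.1]⟩))
    (h.hasDerivWithinAt_Ioi (by simp))
    (by simpa [h2] using h.hasDerivWithinAt_Ioi_reverse (u := 1) (by simp))
  have := h.simple ⟨by linarith [hs.1], by linarith [hs.2]⟩
    ⟨by linarith [ht.2], by linarith [ht.1]⟩ hst
  linarith [hs.2, ht.2]

/-- Injectivity is given only on the open interval, so a return to the starting point has to be
excluded. There the tangents would be parallel, and an arc from `w`, run forwards or backwards,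
would meet the initial arc; half of `min w (1 - w)` keeps the parameter ranges apart. -/
lemma start_ne (h : IsThickCurve f T ℓ Δ) {w : ℝ} (hw : w ∈ Ioo (0 : ℝ) 1) : f 0 ≠ f w := by
  intro heq
  have h0 : (0 : ℝ) ∈ Icc (0 : ℝ) 1 := by simp
  have hw' : w ∈ Icc (0 : ℝ) 1 := ⟨hw.1.le, hw.2.le⟩
  obtain ⟨hw0, hw1⟩ := hw
  have hη : 0 < min w (1 - w) / 2 := by
    have : 0 < min w (1 - w) := lt_min hw0 (by linarith)
    linarith
  have hηw : min w (1 - w) ≤ w := min_le_left _ _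
  have hηw' : min w (1 - w) ≤ 1 - w := min_le_right _ _
  rcases h.tangent_eq_or_eq_neg h0 hw' heq with h2 | h2
  · obtain ⟨s, hs, t, ht, hst⟩ := h.bound.arcs_meet h.thickness_pos (p := f 0) (e := T 0)
      ⟨0, h0, rfl⟩ (h.norm_tangent 0 h0) (γ₁ := fun s => f (0 + s)) (γ₂ := fun s => f (w + s))
      (η := min w (1 - w) / 2) hη h.speed_pos (by simp) (by simp [heq])
      (fun s hs => ⟨0 + s, ⟨by linarith [hs.1], by linarith [hs.2]⟩, rfl⟩)
      (fun s hs => ⟨w + s, ⟨by linarith [hs.1], by linarith [hs.2]⟩, rfl⟩)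
      (h.continuousOn.comp (by fun_prop) (fun s hs => ⟨by linarith [hs.1], by linarith [hs.2]⟩))
      (h.hasDerivWithinAt_Ioi (by simp))
      (by simpa [h2] using h.hasDerivWithinAt_Ioi (u := w) ⟨hw0.le, hw1⟩)
    have := h.simple ⟨by linarith [hs.1], by linarith [hs.2]⟩
      ⟨by linarith [ht.1], by linarith [ht.2]⟩ hst
    linarith [hs.2, ht.1]
  · obtain ⟨s, hs, t, ht, hst⟩ := h.bound.arcs_meet h.thickness_pos (p := f 0) (e := T 0)
      ⟨0, h0, rfl⟩ (h.norm_tangent 0 h0) (γ₁ := fun s => f (0 + s)) (γ₂ := fun s => f (w - s))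
      (η := min w (1 - w) / 2) hη h.speed_pos (by simp) (by simp [heq])
      (fun s hs => ⟨0 + s, ⟨by linarith [hs.1], by linarith [hs.2]⟩, rfl⟩)
      (fun s hs => ⟨w - s, ⟨by linarith [hs.2], by linarith [hs.1]⟩, rfl⟩)
      (h.continuousOn.comp (by fun_prop) (fun s hs => ⟨by linarith [hs.2], by linarith [hs.1]⟩))
      (h.hasDerivWithinAt_Ioi (by simp))
      (by simpa [h2] using h.hasDerivWithinAt_Ioi_reverse (u := w) ⟨hw0, hw1.le⟩)
    have := h.simple ⟨by linarith [hs.1], by linarith [hs.2]⟩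
      ⟨by linarith [ht.2], by linarith [ht.1]⟩ hst
    linarith [hs.2, ht.2]

lemma injOn_Ico (h : IsThickCurve f T ℓ Δ) : InjOn f (Ico 0 1) := by
  intro u hu v hv huv
  rcases eq_or_lt_of_le hu.1 with hu0 | hu0 <;> rcases eq_or_lt_of_le hv.1 with hv0 | hv0
  · rw [← hu0, ← hv0]
  · rw [← hu0] at huv; exact absurd huv (h.start_ne ⟨hv0, hv.2⟩)
  · rw [← hv0] at huv; exact absurd huv.symm (h.start_ne ⟨hu0, hu.2⟩)
  · exact h.simple ⟨hu0, hu.2⟩ ⟨hv0, hv.2⟩ huv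

lemma eq_of_apply_eq (h : IsThickCurve f T ℓ Δ) {u v : ℝ} (hu : u ∈ Icc (0 : ℝ) 1)
    (hv : v ∈ Icc (0 : ℝ) 1) (huv : f u = f v) :
    u = v ∨ (u = 0 ∧ v = 1) ∨ (u = 1 ∧ v = 0) := by
  rcases eq_or_lt_of_le hu.2 with hu1 | hu1 <;> rcases eq_or_lt_of_le hv.2 with hv1 | hv1
  · left; rw [hu1, hv1]
  · right; right
    rw [hu1, ← h.closed] at huv
    exact ⟨hu1, (h.injOn_Ico (by simp) ⟨hv.1, hv1⟩ huv).symm⟩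
  · right; left
    rw [hv1, ← h.closed] at huv
    exact ⟨h.injOn_Ico ⟨hu.1, hu1⟩ (by simp) huv, hv1⟩
  · exact Or.inl (h.injOn_Ico ⟨hu.1, hu1⟩ ⟨hv.1, hv1⟩ huv)

lemma tangent_eq_of_apply_eq (h : IsThickCurve f T ℓ Δ) {u v : ℝ} (hu : u ∈ Icc (0 : ℝ) 1)
    (hv : v ∈ Icc (0 : ℝ) 1) (huv : f u = f v) : T u = T v := by
  rcases h.eq_of_apply_eq hu hv huv with rfl | ⟨rfl, rfl⟩ | ⟨rfl, rfl⟩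
  · rfl
  · exact h.tangent_closed.symm
  · exact h.tangent_closed

/-- Both tangents make a small angle with the line of the chord `w`, by tangency from either end;
each contributes half of the bound. -/
lemma abs_cross_tangent_le (h : IsThickCurve f T ℓ Δ) {u v : ℝ} (hu : u ∈ Icc (0 : ℝ) 1)
    (hv : v ∈ Icc (0 : ℝ) 1) : Δ * |cross (T u) (T v)| ≤ ‖f v - f u‖ := by
  by_cases hw : f v - f u = 0
  · rw [h.cross_tangent_eq_zero hu hv (sub_eq_zero.1 hw).symm]; simp
  set w := f v - f u with hwdef
  have hw0 : 0 < ‖w‖ := norm_pos_iff.2 hw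
  have h1 := h.tangency hu ⟨v, hv, rfl⟩
  have h2 := h.tangency hv ⟨u, hu, rfl⟩
  have e2 : f u - f v = (-1 : ℝ) • w := by simp [hwdef]
  rw [e2, cross_smul_right, norm_smul, abs_mul] at h2
  rw [← hwdef] at h1
  simp only [abs_neg, abs_one, one_mul, norm_neg, norm_one] at h2
  have hid : ‖w‖ ^ 2 * cross (T u) (T v) =
      cross (T u) w * inner ℝ (T v) w - inner ℝ (T u) w * cross (T v) w := by
    rw [plane_norm_sq, plane_inner, plane_inner]; simp only [cross]; ring
  have i1 : |inner ℝ (T u) w| ≤ ‖w‖ := by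
    simpa [h.norm_tangent u hu] using abs_real_inner_le_norm (T u) w
  have i2 : |inner ℝ (T v) w| ≤ ‖w‖ := by
    simpa [h.norm_tangent v hv] using abs_real_inner_le_norm (T v) w
  have hab : ‖w‖ ^ 2 * |cross (T u) (T v)| ≤ |cross (T u) w| * ‖w‖ + ‖w‖ * |cross (T v) w| := by
    have : ‖w‖ ^ 2 * |cross (T u) (T v)| = |‖w‖ ^ 2 * cross (T u) (T v)| := by
      rw [abs_mul, abs_of_pos (by positivity : 0 < ‖w‖ ^ 2)]
    rw [this, hid]
    refine (abs_sub _ _).trans ?_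
    rw [abs_mul, abs_mul]
    gcongr
  have hΔ := h.thickness_pos
  have : ‖w‖ ^ 2 * (Δ * |cross (T u) (T v)|) ≤ ‖w‖ ^ 2 * ‖w‖ := by
    have := mul_le_mul_of_nonneg_left hab hΔ.le
    nlinarith
  exact le_of_mul_le_mul_left this (by positivity)

/-- Since `T` is not yet known to be continuous, Darboux's theorem is used: `t ↦ ⟨T u, f t⟩` has
derivative `ℓ ⟨T u, T t⟩`, which could vanish only where `|cross (T u) (T t)| = 1`, that is, at
parameter distance at least `Δ / ℓ`. -/
lemma inner_tangent_pos (h : IsThickCurve f T ℓ Δ) {u v : ℝ} (hu : u ∈ Icc (0 : ℝ) 1)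
    (hv : v ∈ Icc (0 : ℝ) 1) (huv : ℓ * |v - u| < Δ) : 0 < inner ℝ (T u) (T v) := by
  have hℓ := h.speed_pos
  have hΔ := h.thickness_pos
  set s : Set ℝ := Icc 0 1 ∩ closedBall u |v - u|
  have hs : Convex ℝ s := (convex_Icc 0 1).inter (convex_closedBall _ _)
  have hd : ∀ x ∈ s, HasDerivWithinAt (fun t => inner ℝ (T u) (f t))
      (inner ℝ (T u) (ℓ • T x)) s x := by
    intro x hx
    have := (hasDerivWithinAt_const x s (T u)).inner ℝ
      ((h.hasDeriv x hx.1).mono inter_subset_left)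
    simpa using this
  have hne : ∀ x ∈ s, inner ℝ (T u) (ℓ • T x) ≠ 0 := by
    intro x hx h0
    rw [inner_smul_right, mul_eq_zero] at h0
    have h0' := h0.resolve_left hℓ.ne'
    have h1 := inner_sq_add_cross_sq (T u) (T x)
    rw [h0', h.norm_tangent u hu, h.norm_tangent x hx.1] at h1
    have h2 : |cross (T u) (T x)| = 1 := by
      apply (sq_eq_sq₀ (abs_nonneg _) zero_le_one).1
      rw [sq_abs]; linarith
    have h3 := h.abs_cross_tangent_le hu hx.1
    rw [h2] at h3
    have h4 := h.norm_sub_le hu hx.1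
    have h5 : |x - u| ≤ |v - u| := by simpa [Real.dist_eq] using hx.2
    nlinarith
  have hus : u ∈ s := ⟨hu, by simp⟩
  have hvs : v ∈ s := ⟨hv, by simp [Real.dist_eq]⟩
  rcases hasDerivWithinAt_forall_lt_or_forall_gt_of_forall_ne hs hd hne with h1 | h1
  · have := h1 u hus
    rw [inner_smul_right, real_inner_self_eq_norm_sq, h.norm_tangent u hu] at this
    linarith
  · have := h1 v hvs
    rw [inner_smul_right] at this
    exact (mul_pos_iff_of_pos_left hℓ).1 this

lemma continuousOn_tangent (h : IsThickCurve f T ℓ Δ) : ContinuousOn T (Icc 0 1) := by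
  have hℓ := h.speed_pos
  have hΔ := h.thickness_pos
  intro u hu
  have key : ∀ᶠ v in 𝓝[Icc 0 1] u, ‖T v - T u‖ ≤ 2 * (ℓ / Δ * |v - u|) := by
    have hev : ∀ᶠ v in 𝓝[Icc 0 1] u, ℓ * |v - u| < Δ := by
      have : Continuous fun v : ℝ => ℓ * |v - u| := by fun_prop
      exact (this.continuousAt.eventually (gt_mem_nhds (by simpa using hΔ))).filter_mono
        nhdsWithin_le_nhds
    filter_upwards [hev, self_mem_nhdsWithin] with v hv hvI
    have h1 := h.inner_tangent_pos hu hvI hv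
    have h2 := inner_sq_add_cross_sq (T u) (T v)
    have h3 : ‖T v - T u‖ ^ 2 = 2 - 2 * inner ℝ (T u) (T v) := by
      rw [norm_sub_sq_real, h.norm_tangent u hu, h.norm_tangent v hvI, real_inner_comm]; ring
    rw [h.norm_tangent u hu, h.norm_tangent v hvI] at h2
    have h4 : |cross (T u) (T v)| ≤ ℓ / Δ * |v - u| := by
      have := (h.abs_cross_tangent_le hu hvI).trans (h.norm_sub_le hu hvI)
      rw [div_mul_eq_mul_div, le_div_iff₀ hΔ]; linarith
    -- For an angle with nonnegative cosine `c`, `2 (1 - c) ≤ 4 (1 - c²)`.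
    have h5 : ‖T v - T u‖ ^ 2 ≤ (2 * |cross (T u) (T v)|) ^ 2 := by
      rw [mul_pow, sq_abs, h3]; nlinarith
    have h6 := (sq_le_sq₀ (norm_nonneg _) (by positivity)).1 h5
    linarith
  have hz : Tendsto (fun v => 2 * (ℓ / Δ * |v - u|)) (𝓝[Icc 0 1] u) (𝓝 0) := by
    have : Continuous fun v : ℝ => 2 * (ℓ / Δ * |v - u|) := by fun_prop
    have h1 := this.tendsto u
    simp only [sub_self, abs_zero, mul_zero] at h1
    exact h1.mono_left nhdsWithin_le_nhds
  exact tendsto_iff_norm_sub_tendsto_zero.2 (squeeze_zero' (by simp) key hz)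

end IsThickCurve

lemma IsClosedFilament.exists_isThickCurve {f : ℝ → Plane} (hf : IsClosedFilament f)
    (hΔ : 0 < thickness (filament f)) :
    ∃ (T : ℝ → Plane) (ℓ : ℝ), IsThickCurve f T ℓ (thickness (filament f)) ∧
      ∀ u, unitNormal f u = rot (T u) := by
  obtain ⟨ℓ, hℓ, h⟩ := hf.constant_speed
  refine ⟨fun u => ‖derivWithin f (Icc 0 1) u‖⁻¹ • derivWithin f (Icc 0 1) u, ℓ,
    ⟨hℓ, hΔ, fun u hu => ?_, fun u hu => ?_, threePointBound_thickness _, hf.simple, hf.closed⟩,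
    fun u => by rw [rot_smul, unitNormal]⟩
  · simp only [h u hu, smul_smul, mul_inv_cancel₀ hℓ.ne', one_smul]
    exact (hf.differentiableOn u hu).hasDerivWithinAt
  · rw [norm_smul, norm_inv, norm_norm, h u hu, inv_mul_cancel₀ (ne_of_gt hℓ)]

/-! ### Unicoherence and the two sides of the curve. -/

/-- A form of the unicoherence of the plane: two closed connected sets that cover the plane cannot
have an intersection that is separated by a continuous function. -/
lemma not_separated_inter_of_union_eq_univ {A B : Set Plane} (hA : IsClosed A) (hB : IsClosed B)
    (hA' : IsPreconnected A) (hB' : IsPreconnected B) (hAB : A ∪ B = univ) {w : Plane → ℝ}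
    (hw : Continuous w) (h01 : ∀ x ∈ A ∩ B, w x = 0 ∨ w x = 1) {a b : Plane} (ha : a ∈ A ∩ B)
    (hb : b ∈ A ∩ B) (hwa : w a = 0) (hwb : w b = 1) : False := by
  classical
  -- The two formulas agree on `A ∩ B` because `exp(iπ) = exp(-iπ)`. A lift `θ` of `F` would have to
  -- change by `π` from `a` to `b` when compared along `A`, and by `-π` when compared along `B`.
  set F : Plane → Circle := fun x => if x ∈ A then Circle.exp (Real.pi * w x)
    else Circle.exp (-(Real.pi * w x)) with hF
  have hFA : ∀ x ∈ A, F x = Circle.exp (Real.pi * w x) := fun x hx => by simp [hF, hx]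
  have hFB : ∀ x ∈ B, F x = Circle.exp (-(Real.pi * w x)) := by
    intro x hx
    by_cases hxA : x ∈ A
    · rw [hFA x hxA]
      rcases h01 x ⟨hxA, hx⟩ with h | h
      · simp [h]
      · rw [h, Circle.exp_eq_exp]; exact ⟨1, by push_cast; ring⟩
    · simp [hF, hxA]
  have hFc : Continuous F := by
    rw [← continuousOn_univ, ← hAB]
    refine ContinuousOn.union_of_isClosed ?_ ?_ hA hB
    · exact ContinuousOn.congr (f := fun x => Circle.exp (Real.pi * w x))
        (by fun_prop) (fun x hx => hFA x hx)
    · exact ContinuousOn.congr (f := fun x => Circle.exp (-(Real.pi * w x)))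
        (by fun_prop) (fun x hx => hFB x hx)
  obtain ⟨θ, ⟨-, hθ⟩, -⟩ := Circle.isCoveringMap_exp.existsUnique_continuousMap_lifts
    (⟨F, hFc⟩ : C(Plane, Circle)) a 0 (by simp [hFA a ha.1, hwa])
  have hθ' : ∀ x, Circle.exp (θ x) = F x := fun x => congrFun hθ x
  have hconst : ∀ {S : Set Plane}, IsPreconnected S → ∀ g : Plane → ℝ, Continuous g →
      (∀ x ∈ S, F x = Circle.exp (g x)) → a ∈ S → b ∈ S → θ a - g a = θ b - g b := by
    intro S hS g hg hFg haS hbS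
    have hint : ∀ x ∈ S, ∃ m : ℤ, (θ x - g x) / (2 * Real.pi) = m := by
      intro x hx
      obtain ⟨m, hm⟩ := Circle.exp_eq_exp.1 ((hθ' x).trans (hFg x hx))
      refine ⟨m, ?_⟩
      rw [hm]; field_simp; ring
    have hdis : IsDiscrete (range ((↑) : ℤ → ℝ)) := by
      exact Int.isClosedEmbedding_coe_real.isInducing.isDiscrete_range
    have := hS.constant_of_mapsTo hdis (f := fun x => (θ x - g x) / (2 * Real.pi))
      (by fun_prop) (fun x hx => by obtain ⟨m, hm⟩ := hint x hx; exact ⟨m, hm.symm⟩) haS hbS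
    have hpi := Real.pi_pos
    exact (div_left_inj' (by positivity)).1 this
  have h1 := hconst hA' _ (by fun_prop) hFA ha.1 hb.1
  have h2 := hconst hB' _ (by fun_prop) hFB ha.2 hb.2
  rw [hwa, hwb] at h1 h2
  linarith [Real.pi_pos]

/-- The points `x` reached from a closest point `f u` of the curve by moving in the direction
`N u`. -/
def normalSide (f N : ℝ → Plane) : Set Plane :=
  {x | ∃ u ∈ Icc (0 : ℝ) 1, x = f u + infDist x (filament f) • N u}

section normalSide

variable {f N : ℝ → Plane}

lemma isCompact_filament (hf : ContinuousOn f (Icc 0 1)) : IsCompact (filament f) :=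
  isCompact_Icc.image_of_continuousOn hf

lemma filament_nonempty (f : ℝ → Plane) : (filament f).Nonempty :=
  ⟨f 0, 0, by simp, rfl⟩

lemma mem_filament {u : ℝ} (hu : u ∈ Icc (0 : ℝ) 1) : f u ∈ filament f := ⟨u, hu, rfl⟩

lemma isClosed_normalSide (hf : ContinuousOn f (Icc 0 1)) (hN : ContinuousOn N (Icc 0 1)) :
    IsClosed (normalSide f N) := by
  have hf' : Continuous fun u : Icc (0 : ℝ) 1 => f u := continuousOn_iff_continuous_domRestrict.1 hf
  have hN' : Continuous fun u : Icc (0 : ℝ) 1 => N u := continuousOn_iff_continuous_domRestrict.1 hN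
  have hd : Continuous fun x : Plane => infDist x (filament f) := continuous_infDist_pt _
  have hcl : IsClosed {p : Icc (0 : ℝ) 1 × Plane |
      p.2 = f p.1 + infDist p.2 (filament f) • N p.1} :=
    isClosed_eq continuous_snd ((hf'.comp continuous_fst).add
      ((hd.comp continuous_snd).smul (hN'.comp continuous_fst)))
  convert isClosedMap_snd_of_compactSpace _ hcl using 1
  ext x
  constructor
  · rintro ⟨u, hu, hx⟩
    exact ⟨(⟨u, hu⟩, x), hx, rfl⟩
  · rintro ⟨⟨u, y⟩, hy, rfl⟩
    exact ⟨u, u.2, hy⟩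

lemma filament_subset_normalSide : filament f ⊆ normalSide f N := by
  rintro x ⟨u, hu, rfl⟩
  exact ⟨u, hu, by rw [infDist_zero_of_mem (mem_filament hu)]; simp⟩

/-- Each point is joined to the connected curve by its normal segment, which stays on the same side:
a closest point of the end of the segment is also closest to every point on it. -/
lemma isPreconnected_normalSide (hf : ContinuousOn f (Icc 0 1))
    (hN : ∀ u ∈ Icc (0 : ℝ) 1, ‖N u‖ = 1) : IsPreconnected (normalSide f N) := by
  refine isPreconnected_of_forall (f 0) ?_
  rintro y ⟨u, hu, hy⟩
  set d := infDist y (filament f)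
  have hd : 0 ≤ d := infDist_nonneg
  have hseg : IsPreconnected ((fun t => f u + t • N u) '' Icc 0 d) :=
    isPreconnected_Icc.image _ (by fun_prop)
  have hΓ : IsPreconnected (filament f) := isPreconnected_Icc.image _ hf
  refine ⟨filament f ∪ (fun t => f u + t • N u) '' Icc 0 d, ?_, Or.inl ⟨0, by simp, rfl⟩,
    Or.inr ⟨d, ⟨hd, le_rfl⟩, hy.symm⟩, hΓ.union (f u) ⟨u, hu, rfl⟩ ⟨0, ⟨le_rfl, hd⟩, by simp⟩ hseg⟩
  rintro x (hx | ⟨t, ht, rfl⟩)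
  · exact filament_subset_normalSide hx
  refine ⟨u, hu, ?_⟩
  have hle : infDist (f u + t • N u) (filament f) ≤ t := by
    refine (infDist_le_dist_of_mem (mem_filament hu)).trans ?_
    simp [norm_smul, hN u hu, abs_of_nonneg ht.1]
  have hge : t ≤ infDist (f u + t • N u) (filament f) := by
    have h1 : d ≤ infDist (f u + t • N u) (filament f) + dist y (f u + t • N u) :=
      infDist_le_infDist_add_dist
    have h2 : dist y (f u + t • N u) = d - t := by
      rw [hy, dist_add_left, dist_eq_norm, ← sub_smul, norm_smul, hN u hu, Real.norm_of_nonneg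
        (by linarith [ht.2]), mul_one]
    linarith
  simp only [le_antisymm hle hge]

end normalSide

/-! ### The signed distance and the tubular neighbourhood. -/

/-- A closed curve `f` in the plane, with unit normal `N` and signed distance `g`, that has a
tubular neighbourhood of radius `Δ`. -/
structure IsTube (f N : ℝ → Plane) (g : Plane → ℝ) (Δ : ℝ) : Prop where
  radius_pos : 0 < Δ
  continuousOn : ContinuousOn f (Icc 0 1)
  continuousOn_normal : ContinuousOn N (Icc 0 1)
  closed : f 0 = f 1
  normal_closed : N 0 = N 1
  injOn : InjOn f (Ico 0 1)
  norm_normal : ∀ u ∈ Icc (0 : ℝ) 1, ‖N u‖ = 1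
  tangency : ∀ u ∈ Icc (0 : ℝ) 1, ∀ c ∈ filament f,
    2 * Δ * |inner ℝ (N u) (c - f u)| ≤ ‖c - f u‖ ^ 2
  abs_sub_le : ∀ x y, |g x - g y| ≤ dist x y
  abs_eq : ∀ x, |g x| = infDist x (filament f)
  apply_normal : ∀ u ∈ Icc (0 : ℝ) 1, ∀ t, |t| ≤ Δ → g (f u + t • N u) = t
  exists_eq : ∀ x, ∃ u ∈ Icc (0 : ℝ) 1, x = f u + g x • N u

lemma IsTube.neg {f N : ℝ → Plane} {g : Plane → ℝ} {Δ : ℝ} (h : IsTube f N g Δ) :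
    IsTube f (fun u => -N u) (fun x => -g x) Δ where
  radius_pos := h.radius_pos
  continuousOn := h.continuousOn
  continuousOn_normal := h.continuousOn_normal.neg
  closed := h.closed
  normal_closed := by rw [h.normal_closed]
  injOn := h.injOn
  norm_normal u hu := by rw [norm_neg, h.norm_normal u hu]
  tangency u hu c hc := by rw [inner_neg_left, abs_neg]; exact h.tangency u hu c hc
  abs_sub_le x y := by
    rw [neg_sub_neg, abs_sub_comm]; exact h.abs_sub_le x y
  abs_eq x := by rw [abs_neg, h.abs_eq]
  apply_normal u hu t ht := by
    have := h.apply_normal u hu (-t) (by rwa [abs_neg])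
    rw [neg_smul] at this
    rw [smul_neg, this, neg_neg]
  exists_eq x := by
    obtain ⟨u, hu, hx⟩ := h.exists_eq x
    exact ⟨u, hu, by rw [neg_smul_neg]; exact hx⟩

lemma inner_deriv_nonpos_of_norm_le {γ : ℝ → Plane} {v x : Plane}
    (hd : HasDerivWithinAt γ v (Ioi 0) 0) (h : ∀ᶠ s in 𝓝[>] (0 : ℝ), ‖x - γ 0‖ ≤ ‖x - γ s‖) :
    inner ℝ (x - γ 0) v ≤ 0 := by
  have h1 : HasDerivWithinAt (fun s => ‖x - γ s‖ ^ 2) (2 * inner ℝ (x - γ 0) (-v)) (Ioi 0) 0 :=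
    (hd.const_sub x).norm_sq
  have hs := hasDerivWithinAt_iff_tendsto_slope.1 h1
  have hI : Ioi (0 : ℝ) \ {0} = Ioi 0 := by simp
  rw [hI] at hs
  have : 0 ≤ 2 * inner ℝ (x - γ 0) (-v) := by
    refine ge_of_tendsto hs ?_
    filter_upwards [h, self_mem_nhdsWithin] with s hs hs0
    have hs0' : (0 : ℝ) < s := hs0
    rw [slope_def_field]
    have : ‖x - γ 0‖ ^ 2 ≤ ‖x - γ s‖ ^ 2 := by gcongr
    apply div_nonneg <;> linarith
  rw [inner_neg_right] at this
  linarith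

namespace IsThickCurve

variable {f T : ℝ → Plane} {ℓ Δ : ℝ}

/-- One-sided first variations in both directions. At an end point the missing direction is borrowed
from the other end, where the point and the tangent are the same. -/
lemma inner_tangent_eq_zero_of_closest (h : IsThickCurve f T ℓ Δ) {u : ℝ}
    (hu : u ∈ Icc (0 : ℝ) 1) {x : Plane}
    (hx : ∀ v ∈ Icc (0 : ℝ) 1, ‖x - f u‖ ≤ ‖x - f v‖) : inner ℝ (x - f u) (T u) = 0 := by
  have hℓ := h.speed_pos
  have hright : ∀ w ∈ Ico (0 : ℝ) 1, (∀ v ∈ Icc (0 : ℝ) 1, ‖x - f w‖ ≤ ‖x - f v‖) →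
      inner ℝ (x - f w) (T w) ≤ 0 := by
    intro w hw hmin
    have := inner_deriv_nonpos_of_norm_le (x := x) (h.hasDerivWithinAt_Ioi hw) (by
      filter_upwards [Ioo_mem_nhdsGT (show (0 : ℝ) < 1 - w by linarith [hw.2])] with s hs
      rw [add_zero]
      exact hmin _ ⟨by linarith [hs.1, hw.1], by linarith [hs.2]⟩)
    rw [inner_smul_right, add_zero] at this
    by_contra hc; push Not at hc; nlinarith
  have hleft : ∀ w ∈ Ioc (0 : ℝ) 1, (∀ v ∈ Icc (0 : ℝ) 1, ‖x - f w‖ ≤ ‖x - f v‖) →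
      0 ≤ inner ℝ (x - f w) (T w) := by
    intro w hw hmin
    have := inner_deriv_nonpos_of_norm_le (x := x) (h.hasDerivWithinAt_Ioi_reverse hw) (by
      filter_upwards [Ioo_mem_nhdsGT hw.1] with s hs
      rw [sub_zero]
      exact hmin _ ⟨by linarith [hs.2], by linarith [hs.1, hw.2]⟩)
    rw [inner_neg_right, inner_smul_right, sub_zero] at this
    by_contra hc; push Not at hc; nlinarith
  apply le_antisymm
  · rcases eq_or_lt_of_le hu.2 with rfl | hu1
    · rw [← h.closed] at hx ⊢
      rw [h.tangent_closed]
      exact hright 0 (by simp) hx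
    · exact hright u ⟨hu.1, hu1⟩ hx
  · rcases eq_or_lt_of_le hu.1 with rfl | hu0
    · rw [h.closed] at hx ⊢
      rw [← h.tangent_closed]
      exact hleft 1 (by simp) hx
    · exact hleft u ⟨hu0, hu.2⟩ hx

/-- Expand the square and use tangency. For `|t| < Δ` the second term shows that the foot `f u` is
the unique closest point. -/
lemma le_norm_normal_sub_sq (h : IsThickCurve f T ℓ Δ) {u : ℝ} (hu : u ∈ Icc (0 : ℝ) 1)
    {c : Plane} (hc : c ∈ filament f) (t : ℝ) :
    Δ * t ^ 2 + (Δ - |t|) * ‖c - f u‖ ^ 2 ≤ Δ * ‖f u + t • rot (T u) - c‖ ^ 2 := by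
  have h1 : f u + t • rot (T u) - c = t • rot (T u) - (c - f u) := by abel
  have h2 := h.tangency hu hc
  rw [h1, norm_sub_sq_real (t • rot (T u)), inner_smul_left, inner_rot, norm_smul, norm_rot, h.norm_tangent u hu,
    mul_one, Real.norm_eq_abs, sq_abs]
  simp only [conj_trivial]
  have h3 : t * cross (T u) (c - f u) ≤ |t| * |cross (T u) (c - f u)| := by
    rw [← abs_mul]; exact le_abs_self _
  have h4 := mul_le_mul_of_nonneg_left h2 (abs_nonneg t)
  have hΔ := h.thickness_pos
  nlinarith

lemma infDist_normal (h : IsThickCurve f T ℓ Δ) {u : ℝ} (hu : u ∈ Icc (0 : ℝ) 1) {t : ℝ}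
    (ht : |t| ≤ Δ) : infDist (f u + t • rot (T u)) (filament f) = |t| := by
  apply le_antisymm
  · refine (infDist_le_dist_of_mem (mem_filament hu)).trans ?_
    simp [norm_smul, norm_rot, h.norm_tangent u hu]
  · refine (le_infDist (filament_nonempty f)).2 fun c hc => ?_
    have h1 := h.le_norm_normal_sub_sq hu hc t
    have h2 : 0 ≤ (Δ - |t|) * ‖c - f u‖ ^ 2 := mul_nonneg (by linarith) (by positivity)
    have hΔ := h.thickness_pos
    rw [dist_eq_norm]
    apply abs_le_of_sq_le_sq _ (norm_nonneg _)
    nlinarith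

lemma exists_eq_normal (h : IsThickCurve f T ℓ Δ) (x : Plane) : ∃ u ∈ Icc (0 : ℝ) 1,
    x = f u + infDist x (filament f) • rot (T u) ∨
      x = f u + infDist x (filament f) • -rot (T u) := by
  obtain ⟨y, ⟨u, hu, rfl⟩, hy⟩ :=
    (isCompact_filament h.continuousOn).exists_infDist_eq_dist (filament_nonempty f) x
  refine ⟨u, hu, ?_⟩
  have h0 := h.inner_tangent_eq_zero_of_closest hu (x := x) (fun v hv => by
    rw [← dist_eq_norm, ← dist_eq_norm, ← hy]
    exact infDist_le_dist_of_mem ⟨v, hv, rfl⟩)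
  have hn := h.norm_tangent u hu
  have hT := plane_norm_sq (T u)
  rw [hn] at hT
  rw [plane_inner] at h0
  set w := x - f u with hw
  have hwc : w = cross (T u) w • rot (T u) := by
    apply plane_ext
    · simp only [cross, PiLp.smul_apply, rot_zero_apply, smul_eq_mul]
      linear_combination w 0 * hT + T u 0 * h0
    · simp only [cross, PiLp.smul_apply, rot_one_apply, smul_eq_mul]
      linear_combination w 1 * hT + T u 1 * h0
  have hd : infDist x (filament f) = |cross (T u) w| := by
    rw [hy, dist_eq_norm, ← hw, hwc, cross_smul_right, norm_smul, norm_rot, hn]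
    have : cross (T u) (rot (T u)) = 1 := by
      simp only [cross, rot_zero_apply, rot_one_apply]; linarith
    rw [this]; simp
  have hx : x = f u + w := by simp [hw]
  rcases abs_choice (cross (T u) w) with hc | hc
  · left; rw [hd, hc, ← hwc]; exact hx
  · right; rw [hd, hc, neg_smul_neg, ← hwc]; exact hx

/-- A point at distance in `(0, Δ)` has a unique foot and normal direction, so it lies on one side
only. A common point farther away would leave the intersection split into the curve and a part at
distance at least `Δ`, separated by `min (d / Δ) 1`; unicoherence forbids this. -/
lemma normalSide_inter (h : IsThickCurve f T ℓ Δ) :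
    normalSide f (fun u => rot (T u)) ∩ normalSide f (fun u => -rot (T u)) = filament f := by
  have hΔ := h.thickness_pos
  have hNc : ContinuousOn (fun u => rot (T u)) (Icc 0 1) :=
    continuous_rot.comp_continuousOn h.continuousOn_tangent
  have hn : ∀ u ∈ Icc (0 : ℝ) 1, ‖rot (T u)‖ = 1 := fun u hu => by
    rw [norm_rot, h.norm_tangent u hu]
  have hsmall : ∀ x ∈ normalSide f (fun u => rot (T u)) ∩ normalSide f (fun u => -rot (T u)),
      infDist x (filament f) < Δ → infDist x (filament f) = 0 := by
    rintro x ⟨⟨u, hu, hxu⟩, v, hv, hxv⟩ hlt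
    set d := infDist x (filament f)
    have hd : 0 ≤ d := infDist_nonneg
    have h1 := h.le_norm_normal_sub_sq hu (c := f v) ⟨v, hv, rfl⟩ d
    have h2 : ‖x - f v‖ = d := by
      rw [hxv, add_sub_cancel_left, norm_smul, norm_neg, hn v hv, Real.norm_of_nonneg hd, mul_one]
    rw [← hxu, h2, abs_of_nonneg hd] at h1
    have h3 : f v = f u := by
      rw [← sub_eq_zero, ← norm_eq_zero, ← sq_eq_zero_iff]
      apply le_antisymm _ (by positivity)
      by_contra hc; push Not at hc; nlinarith
    have h4 := h.tangent_eq_of_apply_eq hv hu h3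
    simp only at hxu hxv
    rw [hxu, h3, h4] at hxv
    have h5 : d • rot (T u) = d • -rot (T u) := add_left_cancel hxv
    have h6 : (2 * d) • rot (T u) = 0 := by
      rw [two_mul, add_smul]; nth_rewrite 1 [h5]; simp
    rcases smul_eq_zero.1 h6 with h7 | h7
    · linarith
    · have := hn u hu; rw [h7] at this; simp at this
  apply Subset.antisymm
  · intro x hx
    have hd : infDist x (filament f) = 0 := by
      by_contra hne
      refine not_separated_inter_of_union_eq_univ
        (A := normalSide f (fun u => rot (T u))) (B := normalSide f (fun u => -rot (T u)))
        (isClosed_normalSide h.continuousOn hNc) (isClosed_normalSide h.continuousOn hNc.neg)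
        (isPreconnected_normalSide h.continuousOn hn)
        (isPreconnected_normalSide h.continuousOn (fun u hu => by rw [norm_neg, hn u hu]))
        ?_ (w := fun x => min (infDist x (filament f) / Δ) 1) ?_ ?_ (a := f 0) (b := x)
        ⟨filament_subset_normalSide ⟨0, by simp, rfl⟩,
          filament_subset_normalSide ⟨0, by simp, rfl⟩⟩ hx ?_ ?_
      · rw [eq_univ_iff_forall]
        intro y
        obtain ⟨u, hu, hy | hy⟩ := h.exists_eq_normal y
        · exact Or.inl ⟨u, hu, hy⟩
        · exact Or.inr ⟨u, hu, hy⟩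
      · exact ((continuous_infDist_pt _).div_const _).min continuous_const
      · intro y hy
        by_cases hlt : infDist y (filament f) < Δ
        · left; simp [hsmall y hy hlt]
        · right; push Not at hlt
          exact min_eq_right ((one_le_div hΔ).2 hlt)
      · simp [infDist_zero_of_mem (show f 0 ∈ filament f from ⟨0, by simp, rfl⟩)]
      · by_cases hlt : infDist x (filament f) < Δ
        · exact absurd (hsmall x hx hlt) hne
        · push Not at hlt
          exact min_eq_right ((one_le_div hΔ).2 hlt)
    exact ((isCompact_filament h.continuousOn).isClosed.mem_iff_infDist_zero
      (filament_nonempty f)).2 hd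
  · exact fun x hx => ⟨filament_subset_normalSide hx, filament_subset_normalSide hx⟩

lemma exists_isTube (h : IsThickCurve f T ℓ Δ) : ∃ g, IsTube f (fun u => rot (T u)) g Δ := by
  classical
  have hΔ := h.thickness_pos
  have hNc : ContinuousOn (fun u => rot (T u)) (Icc 0 1) :=
    continuous_rot.comp_continuousOn h.continuousOn_tangent
  have hn : ∀ u ∈ Icc (0 : ℝ) 1, ‖rot (T u)‖ = 1 := fun u hu => by
    rw [norm_rot, h.norm_tangent u hu]
  set A := normalSide f (fun u => rot (T u)) with hA
  set B := normalSide f (fun u => -rot (T u)) with hB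
  have hAcl : IsClosed A := isClosed_normalSide h.continuousOn hNc
  have hBcl : IsClosed B := isClosed_normalSide h.continuousOn hNc.neg
  have hAB : ∀ x, x ∈ A ∨ x ∈ B := by
    intro y
    obtain ⟨u, hu, hy | hy⟩ := h.exists_eq_normal y
    · exact Or.inl ⟨u, hu, hy⟩
    · exact Or.inr ⟨u, hu, hy⟩
  set g : Plane → ℝ := fun x => if x ∈ A then infDist x (filament f) else -infDist x (filament f)
    with hg
  have hgA : ∀ x ∈ A, g x = infDist x (filament f) := fun x hx => by simp [hg, hx]
  have hgB : ∀ x ∈ B, g x = -infDist x (filament f) := by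
    intro x hx
    by_cases hxA : x ∈ A
    · have : x ∈ filament f := by rw [← h.normalSide_inter]; exact ⟨hxA, hx⟩
      rw [hgA x hxA, infDist_zero_of_mem this, neg_zero]
    · simp [hg, hxA]
  -- The segment from one side to the other is connected and covered by `A` and `B`, so it crosses
  -- the curve. This yields the Lipschitz bound for `g` across the curve.
  have hopp : ∀ x ∈ A, ∀ y ∈ B, infDist x (filament f) + infDist y (filament f) ≤ dist x y := by
    intro x hx y hy
    obtain ⟨w, hw, hw'⟩ := isPreconnected_closed_iff.1 (convex_segment x y).isPreconnected A B
      hAcl hBcl (fun z _ => hAB z) ⟨x, left_mem_segment ℝ x y, hx⟩ ⟨y, right_mem_segment ℝ x y, hy⟩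
    have hwΓ : w ∈ filament f := by rw [← h.normalSide_inter]; exact hw'
    rw [← dist_add_dist_of_mem_segment hw, dist_comm w y]
    exact add_le_add (infDist_le_dist_of_mem hwΓ) (infDist_le_dist_of_mem hwΓ)
  refine ⟨g, hΔ, h.continuousOn, hNc, h.closed, by simp only [h.tangent_closed], h.injOn_Ico, hn,
    fun u hu c hc => by rw [inner_rot]; exact h.tangency hu hc, ?_, ?_, ?_, ?_⟩
  · have hlip : ∀ x y, |infDist x (filament f) - infDist y (filament f)| ≤ dist x y := by
      intro x y
      rw [abs_sub_le_iff]
      constructor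
      · linarith [infDist_le_infDist_add_dist (s := filament f) (x := x) (y := y)]
      · linarith [infDist_le_infDist_add_dist (s := filament f) (x := y) (y := x), dist_comm x y]
    intro x y
    rcases hAB x with hx | hx <;> rcases hAB y with hy | hy
    · rw [hgA x hx, hgA y hy]; exact hlip x y
    · rw [hgA x hx, hgB y hy, sub_neg_eq_add, abs_of_nonneg (add_nonneg infDist_nonneg infDist_nonneg)]
      exact hopp x hx y hy
    · rw [hgB x hx, hgA y hy, ← neg_add', abs_neg,
        abs_of_nonneg (add_nonneg infDist_nonneg infDist_nonneg), add_comm, dist_comm]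
      exact hopp y hy x hx
    · rw [hgB x hx, hgB y hy, neg_sub_neg, abs_sub_comm]; exact hlip x y
  · intro x
    rcases hAB x with hx | hx
    · rw [hgA x hx, abs_of_nonneg infDist_nonneg]
    · rw [hgB x hx, abs_neg, abs_of_nonneg infDist_nonneg]
  · intro u hu t ht
    have hd := h.infDist_normal hu ht
    rcases le_total 0 t with h0 | h0
    · rw [abs_of_nonneg h0] at hd
      rw [hgA _ ⟨u, hu, by rw [hd]⟩, hd]
    · rw [abs_of_nonpos h0] at hd
      rw [hgB _ ⟨u, hu, by rw [hd, neg_smul_neg]⟩, hd, neg_neg]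
  · intro x
    rcases hAB x with hx | hx
    · obtain ⟨u, hu, hxu⟩ := hx
      exact ⟨u, hu, by rw [hgA x ⟨u, hu, hxu⟩]; exact hxu⟩
    · obtain ⟨u, hu, hxu⟩ := hx
      exact ⟨u, hu, by rw [hgB x ⟨u, hu, hxu⟩, neg_smul, ← smul_neg]; exact hxu⟩

end IsThickCurve

/-! ### The deterministic bound for medial estimators. -/

/-- `hausdorffDist` takes the value `0` when the extended distance is infinite; nonempty bounded
sets exclude that case, and compactness gives an attained distance. -/
lemma IsCompact.exists_dist_le_hausdorffDist {A B : Set Plane} (hA : IsCompact A)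
    (hB : IsCompact B) (hB' : B.Nonempty) {x : Plane} (hx : x ∈ A) :
    ∃ y ∈ B, dist x y ≤ hausdorffDist A B := by
  obtain ⟨y, hy, hxy⟩ := hB.exists_infDist_eq_dist hB' x
  refine ⟨y, hy, ?_⟩
  rw [← hxy]
  exact infDist_le_hausdorffDist_of_mem hx
    (hausdorffEDist_ne_top_of_nonempty_of_bounded ⟨x, hx⟩ hB' hA.isBounded hB.isBounded)

/-- The parallel curve at signed distance `t`. -/
def offsetCurve (f N : ℝ → Plane) (t : ℝ) : Set Plane :=
  (fun u => f u + t • N u) '' Icc 0 1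

/-- The constant in the bound for the medial estimator. -/
noncomputable def medialConst (σ Δ : ℝ) : ℝ := 2 * √Δ + √(16 * Δ * (Δ + σ) / (Δ - σ))

namespace IsTube

variable {f N : ℝ → Plane} {g : Plane → ℝ} {Δ : ℝ}

lemma isCompact_offsetCurve (h : IsTube f N g Δ) (t : ℝ) : IsCompact (offsetCurve f N t) :=
  isCompact_Icc.image_of_continuousOn (h.continuousOn.add (h.continuousOn_normal.const_smul t))

lemma offsetCurve_nonempty (f N : ℝ → Plane) (t : ℝ) : (offsetCurve f N t).Nonempty :=
  ⟨_, 0, by simp, rfl⟩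

lemma continuous_signedDist (h : IsTube f N g Δ) : Continuous g := by
  refine LipschitzWith.continuous (K := 1) (LipschitzWith.of_dist_le_mul fun x y => ?_)
  simpa [Real.dist_eq] using h.abs_sub_le x y

lemma exists_filament_dist (h : IsTube f N g Δ) (x : Plane) :
    ∃ y ∈ filament f, ‖x - y‖ = |g x| := by
  obtain ⟨u, hu, hx⟩ := h.exists_eq x
  refine ⟨f u, mem_filament hu, ?_⟩
  nth_rewrite 1 [hx]
  rw [add_sub_cancel_left, norm_smul, h.norm_normal u hu, mul_one, Real.norm_eq_abs]

/-- The point `z` is outside the open disc of radius `Δ + σ` about `f u + Δ N u`, because `g` is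
1-Lipschitz, and inside the disc of radius `2σ + δ` about `f u + σ N u`. For `δ = 0` the circles are
internally tangent at `f u - σ N u`; for small `δ` the region left has size of order `√δ`. -/
lemma dist_antipode_sq_le (h : IsTube f N g Δ) {σ δ : ℝ} (hσ : 0 < σ) (hσΔ : σ < Δ) {u : ℝ}
    (hu : u ∈ Icc (0 : ℝ) 1) {z : Plane} (hz : g z = -σ)
    (hd : dist (f u + σ • N u) z ≤ 2 * σ + δ) :
    (Δ - σ) * dist z (f u - σ • N u) ^ 2 ≤ (Δ + σ) * (4 * σ * δ + δ ^ 2) := by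
  have hΔ := h.radius_pos
  set ξ := z - (f u + σ • N u) with hξ
  have hn := h.norm_normal u hu
  have h1 : ‖ξ‖ ≤ 2 * σ + δ := by rwa [hξ, ← dist_eq_norm, dist_comm]
  have h2 : Δ + σ ≤ ‖ξ - (Δ - σ) • N u‖ := by
    have h3 := h.abs_sub_le (f u + Δ • N u) z
    rw [h.apply_normal u hu Δ (abs_of_pos hΔ).le, hz, sub_neg_eq_add, abs_of_pos (by linarith),
      dist_comm, dist_eq_norm] at h3
    have heq : ξ - (Δ - σ) • N u = z - (f u + Δ • N u) := by rw [hξ, sub_smul]; abel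
    rw [heq]; exact h3
  have h3 : z - (f u - σ • N u) = ξ + (2 * σ) • N u := by
    rw [hξ, two_mul, add_smul]; abel
  rw [dist_eq_norm, h3, norm_add_sq_real, inner_smul_right, norm_smul, hn, mul_one,
    Real.norm_eq_abs, sq_abs]
  have h4 : (Δ + σ) ^ 2 ≤ ‖ξ - (Δ - σ) • N u‖ ^ 2 := by gcongr
  rw [norm_sub_sq_real, inner_smul_right, norm_smul, hn, mul_one, Real.norm_eq_abs, sq_abs] at h4
  have h5 : ‖ξ‖ ^ 2 ≤ (2 * σ + δ) ^ 2 := by gcongr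
  nlinarith

lemma medial_bound (h : IsTube f N g Δ) {σ ε : ℝ} (hσ : 0 < σ) (hσΔ : σ < Δ)
    {A₀ A₁ Γhat : Set Plane} (hA₀ : IsCompact A₀) (hA₀' : A₀.Nonempty) (hA₁ : IsCompact A₁)
    (hA₁' : A₁.Nonempty) (h₀ : hausdorffDist (offsetCurve f N σ) A₀ ≤ ε)
    (h₁ : hausdorffDist (offsetCurve f N (-σ)) A₁ ≤ ε) (hε : ε < (Δ - σ) / 2)
    (hm : IsMedialEstimator A₀ A₁ Γhat) :
    (∀ m ∈ Γhat, ∃ x ∈ filament f, ‖m - x‖ ≤ 2 * ε) ∧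
    (∀ x ∈ filament f, ∃ m ∈ Γhat, ‖m - x‖ ≤ medialConst σ Δ * √ε) ∧
    hausdorffDist Γhat (filament f) ≤ medialConst σ Δ * √ε := by
  have hΔ := h.radius_pos
  have hε0 : 0 ≤ ε := hausdorffDist_nonneg.trans h₀
  obtain ⟨p, hp, rfl⟩ := hm
  have hc₀ := h.isCompact_offsetCurve σ
  have hc₁ := h.isCompact_offsetCurve (-σ)
  have hsσ : |σ| ≤ Δ := by rw [abs_of_pos hσ]; exact hσΔ.le
  have hsσ' : |-σ| ≤ Δ := by rwa [abs_neg]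
  have hlen : ∀ y ∈ A₀, ∀ u ∈ Icc (0 : ℝ) 1, dist y (f u + σ • N u) ≤ ε →
      dist y (p y) ≤ 2 * σ + 2 * ε := by
    intro y hy u hu hyu
    obtain ⟨w, hw, hw'⟩ := hc₁.exists_dist_le_hausdorffDist hA₁ hA₁'
      (show f u + (-σ) • N u ∈ offsetCurve f N (-σ) from ⟨u, hu, rfl⟩)
    have h1 : dist y (p y) ≤ dist y w := by
      rw [(hp y hy).2]; exact infDist_le_dist_of_mem hw
    have h2 : dist (f u + σ • N u) (f u + (-σ) • N u) = 2 * σ := by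
      rw [dist_add_left, dist_eq_norm, ← sub_smul, norm_smul, h.norm_normal u hu,
        Real.norm_of_nonneg (by linarith)]; ring
    linarith [dist_triangle4 y (f u + σ • N u) (f u + (-σ) • N u) w]
  have hnear : ∀ y ∈ A₀, ∃ z, g z = -σ ∧ dist (p y) z ≤ ε := by
    intro y hy
    obtain ⟨_, ⟨v, hv, rfl⟩, hv'⟩ := hA₁.exists_dist_le_hausdorffDist hc₁
      (offsetCurve_nonempty f N (-σ)) (hp y hy).1
    rw [hausdorffDist_comm] at hv'
    exact ⟨_, h.apply_normal v hv _ hsσ', hv'.trans h₁⟩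
  have part1 : ∀ m ∈ (fun y => midpoint ℝ y (p y)) '' A₀, ∃ x ∈ filament f, ‖m - x‖ ≤ 2 * ε := by
    rintro _ ⟨y, hy, rfl⟩
    obtain ⟨_, ⟨u, hu, rfl⟩, hyu⟩ := hA₀.exists_dist_le_hausdorffDist hc₀
      (offsetCurve_nonempty f N σ) hy
    rw [hausdorffDist_comm] at hyu
    replace hyu := hyu.trans h₀
    obtain ⟨z, hz, hz'⟩ := hnear y hy
    have hL := hlen y hy u hu hyu
    obtain ⟨x, hx, hx'⟩ := h.exists_filament_dist (midpoint ℝ y (p y))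
    refine ⟨x, hx, hx'.le.trans ?_⟩
    have e1 := (abs_le.1 (h.abs_sub_le (midpoint ℝ y (p y)) y)).1
    have e2 := (abs_le.1 (h.abs_sub_le (midpoint ℝ y (p y)) (p y))).2
    rw [dist_midpoint_left] at e1
    rw [dist_midpoint_right] at e2
    have e3 := (abs_le.1 (h.abs_sub_le y (f u + σ • N u))).1
    have e4 := (abs_le.1 (h.abs_sub_le (p y) z)).2
    rw [h.apply_normal u hu _ hsσ] at e3
    rw [hz] at e4
    simp only [Real.norm_ofNat] at e1 e2
    rw [abs_le]
    constructor <;> linarith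
  have part2 : ∀ x ∈ filament f, ∃ m ∈ (fun y => midpoint ℝ y (p y)) '' A₀,
      ‖m - x‖ ≤ medialConst σ Δ * √ε := by
    rintro _ ⟨u, hu, rfl⟩
    obtain ⟨y, hy, hyu⟩ := hc₀.exists_dist_le_hausdorffDist hA₀ hA₀'
      (show f u + σ • N u ∈ offsetCurve f N σ from ⟨u, hu, rfl⟩)
    replace hyu := hyu.trans h₀
    obtain ⟨z, hz, hz'⟩ := hnear y hy
    have hL := hlen y hy u hu (by rwa [dist_comm])
    refine ⟨_, ⟨y, hy, rfl⟩, ?_⟩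
    -- The excess `4ε` consists of `2ε` from the length of the segment and `ε` from the
    -- approximation at each end.
    have hd : dist (f u + σ • N u) z ≤ 2 * σ + 4 * ε := by
      linarith [dist_triangle4 (f u + σ • N u) y (p y) z]
    have key := h.dist_antipode_sq_le hσ hσΔ hu hz hd
    have hB : dist z (f u - σ • N u) ≤ √(16 * Δ * (Δ + σ) / (Δ - σ)) * √ε := by
      rw [← Real.sqrt_mul' _ hε0]
      apply Real.le_sqrt_of_sq_le
      have hpos : 0 < Δ - σ := by linarith
      rw [div_mul_eq_mul_div, le_div_iff₀ hpos]
      have : (Δ + σ) * (4 * σ * (4 * ε) + (4 * ε) ^ 2) ≤ 16 * Δ * (Δ + σ) * ε := by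
        have : 4 * σ * (4 * ε) + (4 * ε) ^ 2 ≤ 16 * Δ * ε := by nlinarith
        nlinarith
      linarith
    have hεΔ : ε ≤ √Δ * √ε := by
      rw [← Real.sqrt_mul hΔ.le]
      apply Real.le_sqrt_of_sq_le
      nlinarith
    have hmid : midpoint ℝ y (p y) - f u =
        (1 / 2 : ℝ) • ((y - (f u + σ • N u)) + ((p y - z) + (z - (f u - σ • N u)))) := by
      rw [midpoint_eq_smul_add]
      have : f u = (1 / 2 : ℝ) • (f u + f u) := by rw [← two_smul ℝ (f u), smul_smul]; norm_num
      nth_rewrite 1 [this]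
      rw [invOf_eq_inv, ← one_div, ← smul_sub]
      congr 1; abel
    have hnorm : ‖midpoint ℝ y (p y) - f u‖ ≤
        1 / 2 * (ε + (ε + √(16 * Δ * (Δ + σ) / (Δ - σ)) * √ε)) := by
      rw [hmid, norm_smul, Real.norm_of_nonneg (by norm_num)]
      gcongr
      refine (norm_add_le _ _).trans (add_le_add ?_ ((norm_add_le _ _).trans (add_le_add ?_ ?_)))
      · rw [← dist_eq_norm, dist_comm]; exact hyu
      · rw [← dist_eq_norm]; exact hz'
      · rw [← dist_eq_norm]; exact hB
    refine hnorm.trans ?_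
    rw [medialConst, add_mul]
    have : 0 ≤ √(16 * Δ * (Δ + σ) / (Δ - σ)) * √ε := by positivity
    linarith
  refine ⟨part1, part2, ?_⟩
  have hεΔ : 2 * ε ≤ medialConst σ Δ * √ε := by
    have h1 : ε ≤ √Δ * √ε := by
      rw [← Real.sqrt_mul hΔ.le]
      apply Real.le_sqrt_of_sq_le
      nlinarith
    rw [medialConst, add_mul]
    have : 0 ≤ √(16 * Δ * (Δ + σ) / (Δ - σ)) * √ε := by positivity
    linarith
  refine hausdorffDist_le_of_mem_dist ((by positivity : 0 ≤ 2 * ε).trans hεΔ) ?_ ?_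
  · intro m hm
    obtain ⟨x, hx, hmx⟩ := part1 m hm
    exact ⟨x, hx, by rw [dist_eq_norm]; exact hmx.trans hεΔ⟩
  · intro x hx
    obtain ⟨m, hm, hmx⟩ := part2 x hx
    exact ⟨m, hm, by rw [dist_comm, dist_eq_norm]; exact hmx⟩

end IsTube

/-! ### Lower bounds for the probability of hitting a small ball. -/

/-- Near the rim the bound is the assumed asymptotics; farther inside, monotonicity bounds `φ` below
by its value on a fixed circle near the rim. -/
lemma IsNoiseDensity.exists_lower_bound {φ : Plane → ℝ} {σ β : ℝ} (h : IsNoiseDensity φ σ β)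
    (hσ : 0 < σ) : ∃ c : ℝ, 0 < c ∧ ∀ v, ‖v‖ < σ → c * (σ - ‖v‖) ^ β ≤ φ v := by
  obtain ⟨hβ, a, ha, heq⟩ := h.boundary_behavior
  obtain ⟨b, hb, hbound⟩ := heq.isBigO_symm.exists_pos
  have hev := hbound.bound
  rw [eventually_comap] at hev
  obtain ⟨l, hl, hlσ⟩ := (mem_nhdsLT_iff_exists_Ioo_subset' (show (0 : ℝ) < σ from hσ)).1 hev
  have hlσ' : ∀ x : Plane, l < ‖x‖ → ‖x‖ < σ → a / b * (σ - ‖x‖) ^ β ≤ φ x := by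
    intro x h1 h2
    have h3 := hlσ ⟨h1, h2⟩ x rfl
    have h4 : 0 ≤ (σ - ‖x‖) ^ β := Real.rpow_nonneg (by linarith) _
    rw [Real.norm_of_nonneg (by positivity), Real.norm_of_nonneg (h.nonneg x)] at h3
    rw [div_mul_eq_mul_div, div_le_iff₀ hb]
    linarith
  set m := (max l 0 + σ) / 2 with hm
  have hmax : max l 0 < σ := max_lt hl hσ
  have hlm : l < m := by have := le_max_left l 0; rw [hm]; linarith
  have h0m : 0 < m := by have := le_max_right l 0; rw [hm]; linarith
  have hmσ : m < σ := by rw [hm]; linarith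
  set xm : Plane := EuclideanSpace.single 0 m
  have hxm : ‖xm‖ = m := by simp [xm, abs_of_pos h0m]
  have hσm : 0 < (σ - m) ^ β := Real.rpow_pos_of_pos (by linarith) _
  have hσβ : 0 < σ ^ β := Real.rpow_pos_of_pos hσ _
  refine ⟨min (a / b) (a / b * (σ - m) ^ β / σ ^ β), by positivity, fun v hv => ?_⟩
  have h4 : 0 ≤ (σ - ‖v‖) ^ β := Real.rpow_nonneg (by linarith) _
  rcases lt_or_ge l ‖v‖ with hlv | hlv
  · exact (mul_le_mul_of_nonneg_right (min_le_left _ _) h4).trans (hlσ' v hlv hv)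
  · refine (mul_le_mul_of_nonneg_right (min_le_right _ _) h4).trans ?_
    have h1 : φ xm ≤ φ v := h.nonincreasing v xm (by rw [hxm]; linarith)
    have h2 := hlσ' xm (by rwa [hxm]) (by rwa [hxm])
    rw [hxm] at h2
    refine le_trans ?_ (h2.trans h1)
    have h3 : (σ - ‖v‖) ^ β ≤ σ ^ β :=
      Real.rpow_le_rpow (by linarith) (by linarith [norm_nonneg v]) hβ
    rw [div_mul_eq_mul_div, div_le_iff₀ hσβ]
    exact mul_le_mul_of_nonneg_left h3 (by positivity)

/-- By tangency, sliding the centre along the curve by an arc of length `l` raises the squared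
distance to `x` by at most `2 l²`, so an arc of order `√η` preserves half of the depth `η`. This is
the source of the exponent `1/2`. -/
lemma IsTube.norm_sub_le_of_infDist_le {f N : ℝ → Plane} {g : Plane → ℝ} {Δ ℓ σ η : ℝ}
    (h : IsTube f N g Δ)
    (hlip : ∀ u ∈ Icc (0 : ℝ) 1, ∀ v ∈ Icc (0 : ℝ) 1, ‖f v - f u‖ ≤ ℓ * |v - u|)
    (hσΔ : σ < Δ) (hη : 0 < η) {x : Plane} (hx : infDist x (filament f) ≤ σ - η) :
    ∃ u₀ ∈ Icc (0 : ℝ) 1, ∀ u ∈ Icc (0 : ℝ) 1, 8 * (ℓ * |u - u₀|) ^ 2 ≤ σ * η →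
      ‖x - f u‖ ≤ σ - η / 2 := by
  have hΔ := h.radius_pos
  obtain ⟨u₀, hu₀, hxu⟩ := h.exists_eq x
  rw [← h.abs_eq] at hx
  set t := g x
  refine ⟨u₀, hu₀, fun u hu hsmall => ?_⟩
  have ht := abs_nonneg t
  have h1 := h.tangency u₀ hu₀ (f u) ⟨u, hu, rfl⟩
  have h2 := hlip u₀ hu₀ u hu
  set w := f u - f u₀ with hw
  have h3 : x - f u = t • N u₀ - w := by rw [hw]; nth_rewrite 1 [hxu]; abel
  have h4 : ‖w‖ ^ 2 ≤ (ℓ * |u - u₀|) ^ 2 := by gcongr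
  have h5 : -(2 * (t * inner ℝ (N u₀) w)) ≤ ‖w‖ ^ 2 := by
    have h6 : -(t * inner ℝ (N u₀) w) ≤ |t| * |inner ℝ (N u₀) w| := by
      rw [← abs_mul]; exact neg_le_abs _
    have h7 : |t| * |inner ℝ (N u₀) w| ≤ Δ * |inner ℝ (N u₀) w| := by
      gcongr; linarith
    linarith
  apply le_of_sq_le_sq _ (by linarith)
  rw [h3, norm_sub_sq_real, inner_smul_left, norm_smul, h.norm_normal u₀ hu₀, mul_one,
    Real.norm_eq_abs]
  simp only [conj_trivial]
  have h8 : |t| ^ 2 ≤ (σ - η) ^ 2 := by gcongr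
  nlinarith

lemma exists_Icc_subset_near {u₀ d : ℝ} (hu₀ : u₀ ∈ Icc (0 : ℝ) 1) (hd : 0 ≤ d)
    (hd' : d ≤ 1 / 2) :
    ∃ a, Icc a (a + d) ⊆ Icc (0 : ℝ) 1 ∧ ∀ u ∈ Icc a (a + d), |u - u₀| ≤ d := by
  rcases le_total u₀ (1 / 2) with h | h
  · refine ⟨u₀, Icc_subset_Icc hu₀.1 (by linarith), fun u hu => abs_le.2 ⟨?_, ?_⟩⟩ <;>
      linarith [hu.1, hu.2]
  · refine ⟨u₀ - d, Icc_subset_Icc (by linarith) (by linarith [hu₀.2]), fun u hu =>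
      abs_le.2 ⟨?_, ?_⟩⟩ <;> linarith [hu.1, hu.2]

instance sFinite_noiseLaw (φ : Plane → ℝ) : SFinite (noiseLaw φ) := by
  unfold noiseLaw; infer_instance

lemma positionLaw_Icc_ge {h : ℝ → ℝ} {c a d : ℝ} (hc : ∀ u ∈ Icc (0 : ℝ) 1, c ≤ h u)
    (ha : Icc a (a + d) ⊆ Icc (0 : ℝ) 1) :
    ENNReal.ofReal c * ENNReal.ofReal d ≤ positionLaw h (Icc a (a + d)) := by
  rw [positionLaw, withDensity_apply _ measurableSet_Icc, Measure.restrict_restrict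
    measurableSet_Icc, inter_eq_left.2 ha]
  calc ENNReal.ofReal c * ENNReal.ofReal d = ∫⁻ _ in Icc a (a + d), ENNReal.ofReal c := by
        rw [setLIntegral_const, Real.volume_Icc, add_sub_cancel_left]
    _ ≤ _ := setLIntegral_mono' measurableSet_Icc
        fun u hu => ENNReal.ofReal_le_ofReal (hc u (ha hu))

lemma noiseLaw_closedBall_ge {φ : Plane → ℝ} {c ρ : ℝ} {y : Plane}
    (hc : ∀ v ∈ closedBall y ρ, c ≤ φ v) :
    ENNReal.ofReal c * volume (closedBall y ρ) ≤ noiseLaw φ (closedBall y ρ) := by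
  rw [noiseLaw, withDensity_apply _ measurableSet_closedBall, ← setLIntegral_const]
  exact setLIntegral_mono' measurableSet_closedBall
    fun v hv => ENNReal.ofReal_le_ofReal (hc v hv)

/-- The pairs (position, noise) for which the observation falls into the closed ball with centre
`x` and radius `ρ`. -/
def hitSet (f : ℝ → Plane) (x : Plane) (ρ : ℝ) : Set (ℝ × Plane) :=
  {q | IccExtend zero_le_one ((Icc (0 : ℝ) 1).domRestrict f) q.1 + q.2 ∈ closedBall x ρ}

/-- The extension `IccExtend` in `hitSet` is continuous on the whole line, whatever `f` does off
`[0,1]`; closedness supplies measurability. -/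
lemma isClosed_hitSet {f : ℝ → Plane} (hf : ContinuousOn f (Icc 0 1)) (x : Plane) (ρ : ℝ) :
    IsClosed (hitSet f x ρ) := by
  have : Continuous (IccExtend zero_le_one ((Icc (0 : ℝ) 1).domRestrict f)) :=
    (continuousOn_iff_continuous_domRestrict.1 hf).Icc_extend'
  exact isClosed_closedBall.preimage ((this.comp continuous_fst).add continuous_snd)

lemma hitSet_probability_ge {f N : ℝ → Plane} {g : Plane → ℝ} {Δ ℓ σ β : ℝ} {h : ℝ → ℝ}
    {φ : Plane → ℝ} (ht : IsTube f N g Δ) (hℓ : 0 < ℓ)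
    (hlip : ∀ u ∈ Icc (0 : ℝ) 1, ∀ v ∈ Icc (0 : ℝ) 1, ‖f v - f u‖ ≤ ℓ * |v - u|)
    (hσ : 0 < σ) (hσΔ : σ < Δ) (hh : IsPositionDensity h) (hφ : IsNoiseDensity φ σ β) :
    ∃ c : ℝ, 0 < c ∧ ∀ x η ρ, 0 < η → 0 ≤ ρ → ρ ≤ η / 4 → infDist x (filament f) ≤ σ - η →
      ENNReal.ofReal (c * ρ ^ 2 * η ^ (β + 1 / 2)) ≤
        ((positionLaw h).prod (noiseLaw φ)) (hitSet f x ρ) := by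
  obtain ⟨c₁, c₂, hc₁, hh'⟩ := hh.bounds
  obtain ⟨cφ, hcφ, hφ'⟩ := hφ.exists_lower_bound hσ
  have hβ := hφ.boundary_behavior.1
  -- The first entry keeps the arc within the range where half of the depth survives; the second
  -- makes the parameter length `k √η` at most `1/2`, so that the interval fits into `[0,1]`.
  set k := min (√σ / (4 * ℓ)) (1 / (2 * √σ)) with hk
  have hsσ : 0 < √σ := Real.sqrt_pos.2 hσ
  have hk0 : 0 < k := by positivity
  set V := (volume (ball (0 : Plane) 1)).toReal with hV
  have hVpos : 0 < V := ENNReal.toReal_pos (measure_ball_pos _ _ one_pos).ne' measure_ball_lt_top.ne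
  refine ⟨c₁ * k * (cφ * (1 / 4) ^ β) * V, by positivity, fun x η ρ hη hρ hρη hx => ?_⟩
  have hησ : η ≤ σ := by linarith [infDist_nonneg (x := x) (s := filament f)]
  obtain ⟨u₀, hu₀, hnear⟩ := ht.norm_sub_le_of_infDist_le hlip hσΔ hη hx
  have hsη : √η ≤ √σ := Real.sqrt_le_sqrt hησ
  have hd : k * √η ≤ 1 / 2 := by
    calc k * √η ≤ 1 / (2 * √σ) * √σ := by gcongr; exact min_le_right _ _
      _ = 1 / 2 := by field_simp
  obtain ⟨a, ha, hau⟩ := exists_Icc_subset_near hu₀ (by positivity) hd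
  have hball : ∀ u ∈ Icc a (a + k * √η), ENNReal.ofReal (cφ * (η / 4) ^ β) *
      (ENNReal.ofReal (ρ ^ 2) * ENNReal.ofReal V) ≤
        noiseLaw φ (Prod.mk u ⁻¹' hitSet f x ρ) := by
    intro u hu
    have huI := ha hu
    have hpre : Prod.mk u ⁻¹' hitSet f x ρ = closedBall (x - f u) ρ := by
      ext v
      simp only [hitSet, mem_preimage, mem_ofPred_eq, mem_closedBall, dist_eq_norm,
        IccExtend_of_mem _ _ huI, domRestrict_apply]
      rw [show f u + v - x = v - (x - f u) by abel]
    have hsm : 8 * (ℓ * |u - u₀|) ^ 2 ≤ σ * η := by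
      have h1 : ℓ * |u - u₀| ≤ √σ / 4 * √η := by
        calc ℓ * |u - u₀| ≤ ℓ * (√σ / (4 * ℓ) * √η) := by
              gcongr; exact (hau u hu).trans (by gcongr; exact min_le_left _ _)
          _ = √σ / 4 * √η := by field_simp
      have h2 : (ℓ * |u - u₀|) ^ 2 ≤ (√σ / 4 * √η) ^ 2 := by gcongr
      rw [mul_pow (√σ / 4), div_pow, Real.sq_sqrt hσ.le, Real.sq_sqrt hη.le] at h2
      have : 0 < σ * η := by positivity
      linarith
    have hxu := hnear u huI hsm
    have hvol : volume (closedBall (x - f u) ρ) = ENNReal.ofReal (ρ ^ 2) * ENNReal.ofReal V := by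
      rw [Measure.addHaar_closedBall _ _ hρ, hV, ENNReal.ofReal_toReal measure_ball_lt_top.ne]
      simp
    rw [hpre, ← hvol]
    apply noiseLaw_closedBall_ge
    intro v hv
    have h1 : ‖v‖ ≤ σ - η / 4 := by
      have h2 : ‖v - (x - f u)‖ ≤ ρ := by simpa [dist_eq_norm] using hv
      have h3 : ‖v‖ ≤ ‖v - (x - f u)‖ + ‖x - f u‖ := by
        simpa using norm_add_le (v - (x - f u)) (x - f u)
      linarith
    refine le_trans ?_ (hφ' v (by linarith))
    gcongr; linarith
  rw [Measure.prod_apply (isClosed_hitSet ht.continuousOn x ρ).measurableSet]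
  calc ENNReal.ofReal (c₁ * k * (cφ * (1 / 4) ^ β) * V * ρ ^ 2 * η ^ (β + 1 / 2))
      = (ENNReal.ofReal (cφ * (η / 4) ^ β) * (ENNReal.ofReal (ρ ^ 2) * ENNReal.ofReal V)) *
        (ENNReal.ofReal c₁ * ENNReal.ofReal (k * √η)) := by
        rw [← ENNReal.ofReal_mul (by positivity), ← ENNReal.ofReal_mul (by positivity),
          ← ENNReal.ofReal_mul (by positivity), ← ENNReal.ofReal_mul (by positivity)]
        congr 1
        rw [Real.rpow_add hη, ← Real.sqrt_eq_rpow, Real.div_rpow hη.le (by norm_num),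
          Real.div_rpow (by norm_num) (by norm_num), Real.one_rpow]
        ring
    _ ≤ (ENNReal.ofReal (cφ * (η / 4) ^ β) * (ENNReal.ofReal (ρ ^ 2) * ENNReal.ofReal V)) *
        positionLaw h (Icc a (a + k * √η)) := by
        gcongr
        exact positionLaw_Icc_ge (fun u hu => (hh' u hu).1) ha
    _ = ∫⁻ _ in Icc a (a + k * √η), (ENNReal.ofReal (cφ * (η / 4) ^ β) *
        (ENNReal.ofReal (ρ ^ 2) * ENNReal.ofReal V)) ∂(positionLaw h) := by
        rw [setLIntegral_const]
    _ ≤ ∫⁻ u in Icc a (a + k * √η), noiseLaw φ (Prod.mk u ⁻¹' hitSet f x ρ) ∂(positionLaw h) :=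
        setLIntegral_mono' measurableSet_Icc hball
    _ ≤ _ := setLIntegral_le_lintegral _ _

/-! ### The rate, and covering by the sample. -/

lemma rate_pos {β : ℝ} {n : ℕ} (hn : 2 ≤ n) : 0 < rate β n := by
  have h2 : (2 : ℝ) ≤ n := by exact_mod_cast hn
  have := Real.log_pos (show (1 : ℝ) < n by linarith)
  unfold rate
  positivity

lemma rate_rpow {β : ℝ} (hβ : 0 ≤ β) (n : ℕ) :
    rate β n ^ (2 + (β + 1 / 2)) = Real.log n / n := by
  rw [rate, ← Real.rpow_mul (div_nonneg (Real.log_natCast_nonneg n) (Nat.cast_nonneg n)),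
    one_div_mul_cancel (by positivity), Real.rpow_one]

lemma tendsto_rate {β : ℝ} (hβ : 0 ≤ β) : Tendsto (rate β) atTop (𝓝 0) := by
  have h1 : Tendsto (fun n : ℕ => Real.log n / n) atTop (𝓝 0) := by
    have := Real.tendsto_pow_log_div_mul_add_atTop 1 0 1 one_ne_zero
    simp only [pow_one, one_mul, add_zero] at this
    exact this.comp tendsto_natCast_atTop_atTop
  have h2 := h1.rpow_const (p := 1 / (2 + (β + 1 / 2))) (Or.inr (by positivity))
  rwa [Real.zero_rpow (by positivity)] at h2

/-- The exponent of the rate is at most `1/2`, and `log n ≥ 1` from `n = 3` on. This makes a grid of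
mesh of order `1/n` negligible against `r_n`. -/
lemma sqrt_le_mul_rate {β : ℝ} (hβ : 0 ≤ β) {n : ℕ} (hn : 3 ≤ n) : √n ≤ n * rate β n := by
  have h3 : (3 : ℝ) ≤ n := by exact_mod_cast hn
  have hn0 : (0 : ℝ) < n := by linarith
  have hlog : 1 ≤ Real.log n := by
    rw [Real.le_log_iff_exp_le hn0]
    linarith [Real.exp_one_lt_d9]
  have h1 : (1 / n : ℝ) ^ (1 / 2 : ℝ) ≤ rate β n := by
    calc (1 / n : ℝ) ^ (1 / 2 : ℝ) ≤ (1 / n : ℝ) ^ (1 / (2 + (β + 1 / 2))) := by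
          apply Real.rpow_le_rpow_of_exponent_ge (by positivity)
          · rw [div_le_one hn0]; linarith
          · apply one_div_le_one_div_of_le <;> linarith
      _ ≤ rate β n := by
          unfold rate; gcongr
  rw [← Real.sqrt_eq_rpow, Real.sqrt_div zero_le_one, Real.sqrt_one] at h1
  calc √n = n * (1 / √n) := by
        rw [mul_one_div, Real.div_sqrt]
    _ ≤ _ := by gcongr

section sample

variable {Ω : Type*} [MeasurableSpace Ω] {P : Measure Ω}
  {h : ℝ → ℝ} {φ : Plane → ℝ} {U : ℕ → Ω → ℝ} {e : ℕ → Ω → Plane} {σ β : ℝ}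

lemma IsFilamentSample.ae_mem (hs : IsFilamentSample P h φ U e) (hφ : IsNoiseDensity φ σ β) :
    ∀ᵐ ω ∂P, ∀ i, U i ω ∈ Icc (0 : ℝ) 1 ∧ ‖e i ω‖ ≤ σ := by
  have h1 : ∀ᵐ u ∂(positionLaw h), u ∈ Icc (0 : ℝ) 1 :=
    (withDensity_absolutelyContinuous _ _).ae_le (ae_restrict_mem measurableSet_Icc)
  have h2 : ∀ᵐ x ∂(noiseLaw φ), ‖x‖ ≤ σ := by
    have hm : MeasurableSet {x : Plane | σ < ‖x‖} := measurableSet_lt measurable_const measurable_norm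
    rw [ae_iff]
    have : {x : Plane | ¬‖x‖ ≤ σ} = {x : Plane | σ < ‖x‖} := by ext x; simp
    rw [this, noiseLaw, withDensity_apply _ hm]
    rw [setLIntegral_congr_fun (g := fun _ => 0) hm
      (fun x hx => by simp only; rw [hφ.support x hx, ENNReal.ofReal_zero])]
    simp
  have h3 : ∀ᵐ q ∂((positionLaw h).prod (noiseLaw φ)), q.1 ∈ Icc (0 : ℝ) 1 ∧ ‖q.2‖ ≤ σ :=
    (Measure.quasiMeasurePreserving_fst.ae h1).and (Measure.quasiMeasurePreserving_snd.ae h2)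
  rw [ae_all_iff]
  intro i
  rw [← (hs.law i).map_eq] at h3
  exact ae_of_ae_map (hs.law i).aemeasurable h3

lemma IsFilamentSample.measure_forall_notMem_le [IsProbabilityMeasure P]
    (hs : IsFilamentSample P h φ U e)
    {B : Set (ℝ × Plane)} (hB : MeasurableSet B) {p : ℝ} (hp : 0 ≤ p)
    (hpB : ENNReal.ofReal p ≤ ((positionLaw h).prod (noiseLaw φ)) B) (n : ℕ) :
    P {ω | ∀ i ∈ Finset.range n, (U i ω, e i ω) ∉ B} ≤ ENNReal.ofReal (Real.exp (-(n * p))) := by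
  have hset : {ω | ∀ i ∈ Finset.range n, (U i ω, e i ω) ∉ B} =
      ⋂ i ∈ Finset.range n, (fun ω => (U i ω, e i ω)) ⁻¹' Bᶜ := by
    ext ω; simp
  rw [hset, hs.indep.measure_inter_preimage_eq_mul _ (fun i _ => hB.compl)]
  have hone : ∀ i, P ((fun ω => (U i ω, e i ω)) ⁻¹' Bᶜ) ≤ ENNReal.ofReal (Real.exp (-p)) := by
    intro i
    have hprob : IsProbabilityMeasure ((positionLaw h).prod (noiseLaw φ)) := by
      rw [← (hs.law i).map_eq]
      exact Measure.isProbabilityMeasure_map (hs.law i).aemeasurable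
    rw [← Measure.map_apply_of_aemeasurable (hs.law i).aemeasurable hB.compl, (hs.law i).map_eq,
      prob_compl_eq_one_sub hB]
    calc 1 - ((positionLaw h).prod (noiseLaw φ)) B ≤ 1 - ENNReal.ofReal p := by gcongr
      _ = ENNReal.ofReal (1 - p) := by rw [ENNReal.ofReal_sub _ hp, ENNReal.ofReal_one]
      _ ≤ _ := ENNReal.ofReal_le_ofReal (Real.one_sub_le_exp_neg p)
  calc ∏ i ∈ Finset.range n, P ((fun ω => (U i ω, e i ω)) ⁻¹' Bᶜ)
      ≤ ∏ _i ∈ Finset.range n, ENNReal.ofReal (Real.exp (-p)) :=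
        Finset.prod_le_prod' fun i _ => hone i
    _ = _ := by
        rw [Finset.prod_const, Finset.card_range, ← ENNReal.ofReal_pow (Real.exp_pos _).le,
          ← Real.exp_nat_mul, mul_neg]

/-- The points of a square grid of mesh `R / n`. -/
noncomputable def gridPoint (R : ℝ) (n : ℕ) (k : ℤ × ℤ) : Plane :=
  !₂[R * k.1 / n, R * k.2 / n]

/-- The indices of the grid points in the square of half side `R`. -/
noncomputable def gridIndex (n : ℕ) : Finset (ℤ × ℤ) := Finset.Icc (-n : ℤ) n ×ˢ Finset.Icc (-n : ℤ) n

lemma card_gridIndex (n : ℕ) : ((gridIndex n).card : ℝ) = (2 * n + 1) ^ 2 := by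
  have : (Finset.Icc (-n : ℤ) n).card = 2 * n + 1 := by
    rw [Int.card_Icc]; omega
  rw [gridIndex, Finset.card_product, this]; push_cast; ring

lemma exists_grid_coord {R t : ℝ} (hR : 0 < R) {n : ℕ} (hn : 0 < n) (ht : |t| ≤ R) :
    ∃ k ∈ Finset.Icc (-n : ℤ) n, |t - R * k / n| ≤ R / n := by
  have hn' : (0 : ℝ) < n := by exact_mod_cast hn
  obtain ⟨h1, h2⟩ := abs_le.1 ht
  have hfl := Int.floor_le (t * n / R)
  have hfl' := Int.lt_floor_add_one (t * n / R)
  refine ⟨⌊t * n / R⌋, Finset.mem_Icc.2 ⟨?_, ?_⟩, ?_⟩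
  · rw [Int.le_floor]; push_cast; rw [le_div_iff₀ hR]; nlinarith
  · have : (⌊t * n / R⌋ : ℝ) ≤ n := hfl.trans (by rw [div_le_iff₀ hR]; nlinarith)
    exact_mod_cast this
  · rw [le_div_iff₀ hR] at hfl
    rw [div_lt_iff₀ hR] at hfl'
    have e1 : t - R * ⌊t * n / R⌋ / n = (t * n - ⌊t * n / R⌋ * R) / n := by field_simp
    rw [e1, abs_div, abs_of_pos hn', abs_of_nonneg (by linarith)]
    gcongr; linarith

lemma exists_gridPoint {R : ℝ} (hR : 0 < R) {n : ℕ} (hn : 0 < n) {x : Plane} (hx : ‖x‖ ≤ R) :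
    ∃ k ∈ gridIndex n, dist x (gridPoint R n k) ≤ 2 * R / n := by
  have hn' : (0 : ℝ) < n := by exact_mod_cast hn
  have hsq := plane_norm_sq x
  have hx2 : ‖x‖ ^ 2 ≤ R ^ 2 := by gcongr
  have h0 : |x 0| ≤ R := abs_le_of_sq_le_sq (by nlinarith [sq_nonneg (x 1)]) hR.le
  have h1 : |x 1| ≤ R := abs_le_of_sq_le_sq (by nlinarith [sq_nonneg (x 0)]) hR.le
  obtain ⟨i, hi, hi'⟩ := exists_grid_coord hR hn h0
  obtain ⟨j, hj, hj'⟩ := exists_grid_coord hR hn h1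
  refine ⟨(i, j), Finset.mem_product.2 ⟨hi, hj⟩, ?_⟩
  have e0 : gridPoint R n (i, j) 0 = R * i / n := by simp [gridPoint]
  have e1 : gridPoint R n (i, j) 1 = R * j / n := by simp [gridPoint]
  rw [dist_eq_norm]
  apply le_of_sq_le_sq _ (by positivity)
  rw [plane_norm_sq, PiLp.sub_apply, PiLp.sub_apply, e0, e1, ← sq_abs (x 0 - _), ← sq_abs (x 1 - _)]
  have a0 : |x 0 - R * i / n| ^ 2 ≤ (R / n) ^ 2 := by gcongr
  have a1 : |x 1 - R * j / n| ^ 2 ≤ (R / n) ^ 2 := by gcongr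
  have : 2 * R / n = 2 * (R / n) := by ring
  rw [this]
  nlinarith [sq_nonneg (R / n)]

lemma tsum_ne_top_of_eventually_le_ofReal {a : ℕ → ENNReal} {b : ℕ → ℝ} (hb : Summable b)
    (h1 : ∀ n, a n ≠ ⊤) (h2 : ∀ᶠ n in atTop, a n ≤ ENNReal.ofReal (b n)) : ∑' n, a n ≠ ⊤ := by
  obtain ⟨m, hm⟩ := eventually_atTop.1 h2
  have hsplit := ENNReal.summable.sum_add_tsum_nat_add' (f := a) (k := m)
  have hsum : Summable fun n => b (n + m) := (summable_nat_add_iff m).2 hb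
  have htail : ∑' n, a (n + m) ≠ ⊤ := ne_top_of_le_ne_top hsum.tsum_ofReal_ne_top
    (ENNReal.tsum_le_tsum fun n => hm (n + m) (Nat.le_add_left m n))
  rw [← hsplit]
  exact ENNReal.add_ne_top.2 ⟨ENNReal.sum_ne_top.2 fun i _ => h1 i, htail⟩

/-- With probability one, for all large `n`, every point at depth at least `K r_n` below the
boundary of the `σ`-neighbourhood of the filament is within `ρ r_n` of one of the first `n`
observations, once `ρ` and `K` are large enough. -/
lemma exists_ae_eventually_cover [IsProbabilityMeasure P] {f N : ℝ → Plane} {g : Plane → ℝ} {Δ ℓ : ℝ}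
    (ht : IsTube f N g Δ) (hℓ : 0 < ℓ)
    (hlip : ∀ u ∈ Icc (0 : ℝ) 1, ∀ v ∈ Icc (0 : ℝ) 1, ‖f v - f u‖ ≤ ℓ * |v - u|)
    (hσ : 0 < σ) (hσΔ : σ < Δ) (hh : IsPositionDensity h) (hφ : IsNoiseDensity φ σ β)
    (hs : IsFilamentSample P h φ U e) :
    ∃ M : ℝ, 0 < M ∧ ∀ ρ K : ℝ, 0 < ρ → ρ ≤ K / 4 → M ≤ ρ ^ 2 * K ^ (β + 1 / 2) →
      ∀ᵐ ω ∂P, ∀ᶠ n : ℕ in atTop, ∀ x, infDist x (filament f) ≤ σ - K * rate β n →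
        ∃ i ∈ Finset.range n, dist (f (U i ω) + e i ω) x ≤ ρ * rate β n := by
  obtain ⟨c, hc, hprob⟩ := hitSet_probability_ge ht hℓ hlip hσ hσΔ hh hφ
  have hβ := hφ.boundary_behavior.1
  set α := β + 1 / 2 with hα
  have hα0 : 0 < α := by rw [hα]; linarith
  set c' := c * (1 / 4) * (1 / 2) ^ α with hc'
  have hc'0 : 0 < c' := by positivity
  -- The constant `c'` absorbs the halving of `ρ` and `K` made for the discretization. The `4` gives
  -- each grid point failure probability at most `n⁻⁴`, which beats the `(2n + 1)²` grid points and
  -- leaves a summable `9 n⁻²`.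
  refine ⟨4 / c', by positivity, fun ρ K hρ hρK hM => ?_⟩
  have hK : 0 < K := by linarith
  obtain ⟨R₀, hR₀⟩ := (isCompact_filament ht.continuousOn).isBounded.exists_norm_le
  set R := max R₀ 0 + σ with hRdef
  have hR : 0 < R := by have := le_max_right R₀ 0; linarith
  have hnorm : ∀ x, infDist x (filament f) ≤ σ → ‖x‖ ≤ R := by
    intro x hx
    obtain ⟨y, hy, hxy⟩ := ht.exists_filament_dist x
    rw [ht.abs_eq] at hxy
    have h1 := hR₀ y hy
    have h2 : ‖x‖ ≤ ‖x - y‖ + ‖y‖ := by simpa using norm_add_le (x - y) y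
    have := le_max_left R₀ 0
    rw [hRdef]; linarith
  set bad : ℕ → ℤ × ℤ → Set Ω := fun n k => {ω | infDist (gridPoint R n k) (filament f) ≤
    σ - K / 2 * rate β n ∧ ∀ i ∈ Finset.range n,
      (U i ω, e i ω) ∉ hitSet f (gridPoint R n k) (ρ / 2 * rate β n)} with hbad
  have hbad_le : ∀ n : ℕ, 2 ≤ n → ∀ k, P (bad n k) ≤ ENNReal.ofReal (1 / (n : ℝ) ^ 4) := by
    intro n hn k
    have hr := rate_pos (β := β) hn
    have hn0 : (0 : ℝ) < n := by positivity
    by_cases hz : infDist (gridPoint R n k) (filament f) ≤ σ - K / 2 * rate β n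
    · have hp := hprob _ _ (ρ / 2 * rate β n) (by positivity) (by positivity) (by nlinarith) hz
      have hpe : c * (ρ / 2 * rate β n) ^ 2 * (K / 2 * rate β n) ^ α =
          c' * (ρ ^ 2 * K ^ α) * (Real.log n / n) := by
        rw [← rate_rpow hβ n, Real.rpow_add hr, Real.mul_rpow (by positivity) hr.le,
          Real.div_rpow hK.le (by norm_num), hc', Real.div_rpow (by norm_num) (by norm_num),
          Real.one_rpow, Real.rpow_two]
        ring
      have hlog : 0 ≤ Real.log n := Real.log_natCast_nonneg n
      have h4 : 4 ≤ c' * (ρ ^ 2 * K ^ α) := by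
        rw [div_le_iff₀ hc'0] at hM; linarith
      refine (measure_mono (fun ω hω => hω.2)).trans
        ((hs.measure_forall_notMem_le (isClosed_hitSet ht.continuousOn _ _).measurableSet
          (by positivity) hp n).trans (ENNReal.ofReal_le_ofReal ?_))
      rw [hpe]
      have e1 : (n : ℝ) * (c' * (ρ ^ 2 * K ^ α) * (Real.log n / n)) =
          c' * (ρ ^ 2 * K ^ α) * Real.log n := by field_simp
      rw [e1]
      have e2 : 1 / (n : ℝ) ^ 4 = Real.exp (-(4 * Real.log n)) := by
        rw [Real.exp_neg, mul_comm, Real.exp_mul, Real.exp_log hn0, one_div]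
        norm_cast
      rw [e2, Real.exp_le_exp]
      nlinarith
    · have : bad n k = ∅ := by
        ext ω; simp only [hbad, mem_ofPred_eq, mem_empty_iff_false, iff_false]
        exact fun h => hz h.1
      rw [this]; simp
  have hsum : ∑' n, P (⋃ k ∈ gridIndex n, bad n k) ≠ ⊤ := by
    refine tsum_ne_top_of_eventually_le_ofReal (b := fun n => 9 * (1 / (n : ℝ) ^ 2))
      ((Real.summable_one_div_nat_pow.2 one_lt_two).mul_left 9) (fun n => measure_ne_top _ _) ?_
    filter_upwards [eventually_ge_atTop 2] with n hn
    have hn1 : (1 : ℝ) ≤ n := by exact_mod_cast (by omega : 1 ≤ n)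
    calc P (⋃ k ∈ gridIndex n, bad n k) ≤ ∑ k ∈ gridIndex n, P (bad n k) :=
          measure_biUnion_finset_le _ _
      _ ≤ ∑ _k ∈ gridIndex n, ENNReal.ofReal (1 / (n : ℝ) ^ 4) :=
          Finset.sum_le_sum fun k _ => hbad_le n hn k
      _ = ENNReal.ofReal ((2 * n + 1) ^ 2 * (1 / (n : ℝ) ^ 4)) := by
          rw [Finset.sum_const, nsmul_eq_mul, ← card_gridIndex, ENNReal.ofReal_mul (by positivity),
            ENNReal.ofReal_natCast]
      _ ≤ _ := by
          apply ENNReal.ofReal_le_ofReal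
          rw [mul_one_div, mul_one_div, div_le_div_iff₀ (by positivity) (by positivity)]
          have : (2 * (n : ℝ) + 1) ^ 2 ≤ 9 * n ^ 2 := by nlinarith
          nlinarith [sq_nonneg ((n : ℝ))]
  have hmesh : ∀ᶠ n : ℕ in atTop, 2 * R / n ≤ ρ / 2 * rate β n := by
    have h1 : Tendsto (fun n : ℕ => √(n : ℝ)) atTop atTop :=
      Real.tendsto_sqrt_atTop.comp tendsto_natCast_atTop_atTop
    filter_upwards [h1.eventually_ge_atTop (4 * R / ρ), eventually_ge_atTop 3] with n h2 h3
    have hn0 : (0 : ℝ) < n := by positivity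
    have h4 := h2.trans (sqrt_le_mul_rate hβ h3)
    rw [div_le_iff₀ hρ] at h4
    rw [div_le_iff₀ hn0]
    nlinarith
  filter_upwards [ae_eventually_notMem hsum, hs.ae_mem hφ] with ω hω hmem
  filter_upwards [hω, hmesh, eventually_ge_atTop 2] with n hn hmn hn2 x hx
  have hr := rate_pos (β := β) hn2
  obtain ⟨k, hk, hxk⟩ := exists_gridPoint hR (show 0 < n by omega)
    (hnorm x (hx.trans (by nlinarith)))
  have hxk' := hxk.trans hmn
  -- The grid point is within `(ρ / 2) r_n ≤ (K / 8) r_n` of `x`, so at least half of the depth of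
  -- `x` remains.
  have hkd : infDist (gridPoint R n k) (filament f) ≤ σ - K / 2 * rate β n := by
    have := infDist_le_infDist_add_dist (s := filament f) (x := gridPoint R n k) (y := x)
    rw [dist_comm] at this
    nlinarith
  simp only [mem_iUnion, not_exists] at hn
  have hnk := hn k hk
  simp only [hbad, mem_ofPred_eq, not_and, not_forall, not_not] at hnk
  obtain ⟨i, hi, hhit⟩ := hnk hkd
  refine ⟨i, hi, ?_⟩
  have hd : dist (f (U i ω) + e i ω) (gridPoint R n k) ≤ ρ / 2 * rate β n := by
    have h5 := hhit
    simp only [hitSet, mem_ofPred_eq, mem_closedBall, IccExtend_of_mem _ _ (hmem i).1,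
      domRestrict_apply] at h5
    exact h5
  have := dist_triangle_right (f (U i ω) + e i ω) x (gridPoint R n k)
  linarith

end sample

/-! ### The boundary of the union of balls. -/

lemma IsPreconnected.inter_frontier_nonempty_of_isClosed {X : Type*} [TopologicalSpace X]
    {s A : Set X} (hs : IsPreconnected s) (hA : IsClosed A) (h1 : (s ∩ A).Nonempty)
    (h2 : (s ∩ Aᶜ).Nonempty) : (s ∩ frontier A).Nonempty := by
  rw [frontier_eq_closure_inter_closure, hA.closure_eq]
  refine isPreconnected_closed_iff.1 hs A (closure Aᶜ) hA isClosed_closure (fun x _ => ?_) h1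
    (h2.mono (inter_subset_inter_right _ subset_closure))
  by_cases hx : x ∈ A
  · exact Or.inl hx
  · exact Or.inr (subset_closure hx)

section unionOfBalls

variable {Y : ℕ → Plane} {n : ℕ} {R : ℝ}

lemma mem_unionOfBalls {x : Plane} :
    x ∈ unionOfBalls Y n R ↔ ∃ i ∈ Finset.range n, dist (Y i) x ≤ R := by
  simp only [unionOfBalls, mem_iUnion, mem_closedBall, exists_prop, dist_comm]

lemma isCompact_unionOfBalls : IsCompact (unionOfBalls Y n R) :=
  (Finset.range n).isCompact_biUnion fun _ _ => isCompact_closedBall _ _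

lemma isClosed_unionOfBalls : IsClosed (unionOfBalls Y n R) := isCompact_unionOfBalls.isClosed

lemma isCompact_frontier_unionOfBalls : IsCompact (frontier (unionOfBalls Y n R)) :=
  isCompact_unionOfBalls.of_isClosed_subset isClosed_frontier isClosed_unionOfBalls.frontier_subset

lemma mem_interior_unionOfBalls {x : Plane} (h : ∃ i ∈ Finset.range n, dist (Y i) x < R) :
    x ∈ interior (unionOfBalls Y n R) := by
  obtain ⟨i, hi, hx⟩ := h
  refine mem_interior.2 ⟨ball (Y i) R, fun y hy => mem_unionOfBalls.2 ⟨i, hi, ?_⟩, isOpen_ball, ?_⟩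
  · rw [dist_comm]; exact (mem_ball.1 hy).le
  · rwa [mem_ball, dist_comm]

lemma mem_frontier_unionOfBalls {x : Plane} : x ∈ frontier (unionOfBalls Y n R) ↔
    x ∈ unionOfBalls Y n R ∧ x ∉ interior (unionOfBalls Y n R) := by
  rw [isClosed_unionOfBalls.frontier_eq, Set.mem_sdiff]

end unionOfBalls

namespace IsTube

variable {f N : ℝ → Plane} {g : Plane → ℝ} {Δ σ ε R : ℝ} {Y : ℕ → Plane} {n : ℕ}

lemma infDist_le_of_mem_unionOfBalls (hY : ∀ i, infDist (Y i) (filament f) ≤ σ) {x : Plane}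
    (hx : x ∈ unionOfBalls Y n R) : infDist x (filament f) ≤ σ + R := by
  obtain ⟨i, -, hi⟩ := mem_unionOfBalls.1 hx
  have := infDist_le_infDist_add_dist (s := filament f) (x := x) (y := Y i)
  rw [dist_comm] at this
  linarith [hY i]

/-- The balls reach at most to distance `σ + R`, while every point at distance at most `σ - ε` is in
the interior of their union. -/
lemma abs_signedDist_sub_le (h : IsTube f N g Δ) (hR : R ≤ ε)
    (hY : ∀ i, infDist (Y i) (filament f) ≤ σ)
    (hcov : ∀ x, infDist x (filament f) ≤ σ - ε → ∃ i ∈ Finset.range n, dist (Y i) x < R)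
    {x : Plane} (hx : x ∈ frontier (unionOfBalls Y n R)) : |(|g x| - σ)| ≤ ε := by
  rw [mem_frontier_unionOfBalls] at hx
  have h1 := infDist_le_of_mem_unionOfBalls hY hx.1
  rw [h.abs_eq, abs_le]
  refine ⟨?_, by linarith⟩
  by_contra hc
  push Not at hc
  exact hx.2 (mem_interior_unionOfBalls (hcov x (by linarith)))

lemma dist_offset (h : IsTube f N g Δ) {u : ℝ} (hu : u ∈ Icc (0 : ℝ) 1) (s t : ℝ) :
    dist (f u + s • N u) (f u + t • N u) = |s - t| := by
  rw [dist_add_left, dist_eq_norm, ← sub_smul, norm_smul, h.norm_normal u hu, mul_one,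
    Real.norm_eq_abs]

/-- The part of the boundary of the union of balls on the positive side approximates the parallel
curve. -/
lemma positive_frontier (h : IsTube f N g Δ) (hεσ : ε < σ) (hσΔ : σ + ε ≤ Δ) (hR0 : 0 < R)
    (hR : R < ε) (hY : ∀ i, infDist (Y i) (filament f) ≤ σ)
    (hcov : ∀ x, infDist x (filament f) ≤ σ - ε → ∃ i ∈ Finset.range n, dist (Y i) x < R) :
    IsCompact (frontier (unionOfBalls Y n R) ∩ {x | 0 < g x}) ∧
    (frontier (unionOfBalls Y n R) ∩ {x | 0 < g x}).Nonempty ∧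
    hausdorffDist (offsetCurve f N σ) (frontier (unionOfBalls Y n R) ∩ {x | 0 < g x}) ≤ ε := by
  have hD := fun x hx => h.abs_signedDist_sub_le (Y := Y) (n := n) (x := x) hR.le hY hcov hx
  have hpt : ∀ u ∈ Icc (0 : ℝ) 1, ∃ x ∈ frontier (unionOfBalls Y n R) ∩ {x | 0 < g x},
      dist (f u + σ • N u) x ≤ ε := by
    intro u hu
    have hseg : IsPreconnected ((fun t => f u + t • N u) '' Icc (σ - ε) (σ + ε)) :=
      isPreconnected_Icc.image _ (by fun_prop)
    -- The inner end of the normal segment is covered; the outer end is out of reach because `R <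
    -- ε`.
    obtain ⟨_, ⟨t, ht, rfl⟩, hx⟩ :=
      hseg.inter_frontier_nonempty_of_isClosed (isClosed_unionOfBalls (Y := Y) (n := n) (R := R))
      ⟨_, ⟨σ - ε, ⟨le_rfl, by linarith⟩, rfl⟩, by
        have hin : infDist (f u + (σ - ε) • N u) (filament f) ≤ σ - ε := by
          rw [← h.abs_eq, h.apply_normal u hu _ (by rw [abs_of_pos] <;> linarith),
            abs_of_pos (by linarith)]
        obtain ⟨i, hi, hi'⟩ := hcov _ hin
        exact mem_unionOfBalls.2 ⟨i, hi, hi'.le⟩⟩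
      ⟨_, ⟨σ + ε, ⟨by linarith, le_rfl⟩, rfl⟩, fun hmem => by
        have h1 := infDist_le_of_mem_unionOfBalls hY hmem
        rw [← h.abs_eq, h.apply_normal u hu _ (by rw [abs_of_pos] <;> linarith),
            abs_of_pos (by linarith)] at h1
        linarith⟩
    refine ⟨_, ⟨hx, ?_⟩, ?_⟩
    · change 0 < g _
      rw [h.apply_normal u hu t (by rw [abs_of_pos] <;> linarith [ht.1, ht.2])]
      linarith [ht.1]
    · rw [h.dist_offset hu, abs_le]; constructor <;> linarith [ht.1, ht.2]
  refine ⟨?_, ?_, ?_⟩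
  · have : frontier (unionOfBalls Y n R) ∩ {x | 0 < g x} =
        frontier (unionOfBalls Y n R) ∩ {x | 0 ≤ g x} := by
      ext x
      refine and_congr_right fun hx => ⟨fun h0 => (show 0 < g x from h0).le, fun h0 => ?_⟩
      have h1 := (abs_le.1 (hD x hx)).1
      have h0' : 0 ≤ g x := h0
      rw [abs_of_nonneg h0'] at h1
      change 0 < g x
      linarith
    rw [this]
    exact isCompact_frontier_unionOfBalls.inter_right
      (isClosed_le continuous_const h.continuous_signedDist)
  · obtain ⟨x, hx, -⟩ := hpt 0 (by simp)
    exact ⟨x, hx⟩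
  · refine hausdorffDist_le_of_mem_dist (by linarith) ?_ ?_
    · rintro _ ⟨u, hu, rfl⟩
      exact hpt u hu
    · rintro x ⟨hx, hx0⟩
      obtain ⟨u, hu, hxu⟩ := h.exists_eq x
      refine ⟨_, ⟨u, hu, rfl⟩, ?_⟩
      have h0 : 0 < g x := hx0
      have h1 := hD x hx
      rw [abs_of_pos h0] at h1
      calc dist x (f u + σ • N u) = dist (f u + g x • N u) (f u + σ • N u) := by rw [← hxu]
        _ ≤ ε := by rw [h.dist_offset hu]; exact h1

lemma le_infDist_offsetCurve (h : IsTube f N g Δ) {t : ℝ} (ht : |t| ≤ Δ) (x : Plane) :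
    |g x - t| ≤ infDist x (offsetCurve f N t) := by
  refine (le_infDist (offsetCurve_nonempty f N t)).2 ?_
  rintro _ ⟨u, hu, rfl⟩
  have := h.abs_sub_le x (f u + t • N u)
  rwa [h.apply_normal u hu t ht] at this

lemma infDist_offsetCurve_le (h : IsTube f N g Δ) (t : ℝ) (x : Plane) :
    infDist x (offsetCurve f N t) ≤ |g x - t| := by
  obtain ⟨u, hu, hxu⟩ := h.exists_eq x
  refine (infDist_le_dist_of_mem (show f u + t • N u ∈ offsetCurve f N t from ⟨u, hu, rfl⟩)).trans ?_
  have := h.dist_offset hu (g x) t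
  rw [← hxu] at this
  exact this.le

/-- The distance from `x` to the parallel curve at level `t` is exactly `|g x - t|`, so comparing
the two distances reads off the sign of `g`. -/
lemma infDist_offsetCurve_le_iff (h : IsTube f N g Δ) (hσ : 0 < σ) (hσΔ : σ ≤ Δ) (x : Plane) :
    infDist x (offsetCurve f N σ) ≤ infDist x (offsetCurve f N (-σ)) ↔ 0 ≤ g x := by
  have e1 := le_antisymm (h.infDist_offsetCurve_le σ x)
    (h.le_infDist_offsetCurve (by rwa [abs_of_pos hσ]) x)
  have e2 := le_antisymm (h.infDist_offsetCurve_le (-σ) x)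
    (h.le_infDist_offsetCurve (by rwa [abs_neg, abs_of_pos hσ]) x)
  rw [e1, e2, ← sq_le_sq]
  constructor <;> intro h1 <;> nlinarith

lemma offsetCurve_neg (f N : ℝ → Plane) (t : ℝ) :
    offsetCurve f (fun u => -N u) t = offsetCurve f N (-t) := by
  simp only [offsetCurve, smul_neg, neg_smul]

/-- The medial estimator built from the parts of the boundary of the union of balls on the two sides
of the filament. -/
lemma medial_frontier (h : IsTube f N g Δ) (hεσ : ε < σ) (hσΔ : ε < (Δ - σ) / 2) (hR0 : 0 < R)
    (hR : R < ε) (hY : ∀ i, infDist (Y i) (filament f) ≤ σ)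
    (hcov : ∀ x, infDist x (filament f) ≤ σ - ε → ∃ i ∈ Finset.range n, dist (Y i) x < R)
    {Γhat : Set Plane}
    (hm : IsMedialEstimator (frontier (unionOfBalls Y n R) ∩ {x | 0 < g x})
      (frontier (unionOfBalls Y n R) ∩ {x | g x < 0}) Γhat) :
    hausdorffDist (filament f) Γhat ≤ medialConst σ Δ * √ε := by
  obtain ⟨a1, a2, a3⟩ := h.positive_frontier hεσ (by linarith) hR0 hR hY hcov
  obtain ⟨b1, b2, b3⟩ := h.neg.positive_frontier hεσ (by linarith) hR0 hR hY hcov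
  simp only [Left.neg_pos_iff, offsetCurve_neg] at b1 b2 b3
  rw [hausdorffDist_comm]
  exact (h.medial_bound (by linarith) (by linarith) a1 a2 b1 b2 a3 b3 hσΔ hm).2.2

lemma signedDist_ne_zero (h : IsTube f N g Δ) (hεσ : ε < σ) (hR : R < ε)
    (hY : ∀ i, infDist (Y i) (filament f) ≤ σ)
    (hcov : ∀ x, infDist x (filament f) ≤ σ - ε → ∃ i ∈ Finset.range n, dist (Y i) x < R)
    {x : Plane} (hx : x ∈ frontier (unionOfBalls Y n R)) : g x ≠ 0 := by
  intro h0
  have h1 := (abs_le.1 (h.abs_signedDist_sub_le hR.le hY hcov hx)).1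
  rw [h0, abs_zero] at h1
  linarith

/-- Each curve is connected and avoids `g = 0`, so it lies on one side. Both sides of the frontier
are nonempty, so the curves are the two sign parts, in one of the two orders. -/
lemma medial_splitting (h : IsTube f N g Δ) (hεσ : ε < σ) (hσΔ : ε < (Δ - σ) / 2) (hR0 : 0 < R)
    (hR : R < ε) (hY : ∀ i, infDist (Y i) (filament f) ≤ σ)
    (hcov : ∀ x, infDist x (filament f) ≤ σ - ε → ∃ i ∈ Finset.range n, dist (Y i) x < R)
    {A₀ A₁ Γhat : Set Plane} (hsp : IsTwoCurveSplitting (frontier (unionOfBalls Y n R)) A₀ A₁)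
    (hm : IsMedialEstimator A₀ A₁ Γhat) :
    hausdorffDist (filament f) Γhat ≤ medialConst σ Δ * √ε := by
  obtain ⟨-, a2, -⟩ := h.positive_frontier hεσ (by linarith) hR0 hR hY hcov
  obtain ⟨-, b2, -⟩ := h.neg.positive_frontier hεσ (by linarith) hR0 hR hY hcov
  simp only [Left.neg_pos_iff] at b2
  set D := frontier (unionOfBalls Y n R)
  have hconn : ∀ A, IsSimpleClosedCurve A → A ⊆ D → A ⊆ {x | 0 < g x} ∨ A ⊆ {x | g x < 0} := by
    rintro A ⟨γ, hγ, -, -, rfl⟩ hA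
    refine (isPreconnected_Icc.image _ hγ).subset_or_subset
      (isOpen_lt continuous_const h.continuous_signedDist)
      (isOpen_lt h.continuous_signedDist continuous_const) ?_ ?_
    · exact disjoint_left.2 fun x hx hx' => lt_asymm (show 0 < g x from hx) hx'
    · intro x hx
      exact (h.signedDist_ne_zero hεσ hR hY hcov (hA hx)).symm.lt_or_gt
  have hu := hsp.union
  have hA₀ : A₀ ⊆ D := by rw [← hu]; exact subset_union_left
  have hA₁ : A₁ ⊆ D := by rw [← hu]; exact subset_union_right
  have heq : ∀ (B B' : Set Plane), B ∪ B' = D → B ⊆ {x | 0 < g x} → B' ⊆ {x | g x < 0} →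
      B = D ∩ {x | 0 < g x} ∧ B' = D ∩ {x | g x < 0} := by
    intro B B' hBB hB hB'
    constructor
    · refine Subset.antisymm (fun x hx => ⟨hBB ▸ Or.inl hx, hB hx⟩) ?_
      rintro x ⟨hxD, hx⟩
      rw [← hBB] at hxD
      rcases hxD with hxB | hxB
      · exact hxB
      · exact absurd (show 0 < g x from hx) (lt_asymm (show g x < 0 from hB' hxB))
    · refine Subset.antisymm (fun x hx => ⟨hBB ▸ Or.inr hx, hB' hx⟩) ?_
      rintro x ⟨hxD, hx⟩
      rw [← hBB] at hxD
      rcases hxD with hxB | hxB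
      · exact absurd (show g x < 0 from hx) (lt_asymm (show 0 < g x from hB hxB))
      · exact hxB
  rcases hconn A₀ hsp.curve₀ hA₀ with h0 | h0 <;> rcases hconn A₁ hsp.curve₁ hA₁ with h1 | h1
  · obtain ⟨x, hxD, hx⟩ := b2
    rw [← hu] at hxD
    exact absurd (show g x < 0 from hx) (lt_asymm (show 0 < g x from hxD.elim (@h0 x) (@h1 x)))
  · obtain ⟨rfl, rfl⟩ := heq A₀ A₁ hu h0 h1
    exact h.medial_frontier hεσ hσΔ hR0 hR hY hcov hm
  · obtain ⟨rfl, rfl⟩ := heq A₁ A₀ (by rw [union_comm]; exact hu) h1 h0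
    refine h.neg.medial_frontier hεσ hσΔ hR0 hR hY hcov ?_
    simpa only [Left.neg_pos_iff, Left.neg_neg_iff] using hm
  · obtain ⟨x, hxD, hx⟩ := a2
    rw [← hu] at hxD
    exact absurd (show 0 < g x from hx) (lt_asymm (show g x < 0 from hxD.elim (@h0 x) (@h1 x)))

/-! ### The boundary of the union of balls as two graphs over the filament. -/

lemma eq_of_offset_eq (h : IsTube f N g Δ) {t u v : ℝ} (ht : |t| < Δ) (hu : u ∈ Icc (0 : ℝ) 1)
    (hv : v ∈ Icc (0 : ℝ) 1) (huv : f u + t • N u = f v + t • N v) : f v = f u := by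
  have h1 := h.tangency u hu (f v) ⟨v, hv, rfl⟩
  set w := f v - f u with hw
  have h2 : t • N u - w = t • N v := by
    rw [hw, sub_eq_iff_eq_add, ← add_sub_assoc, add_comm (t • N v), ← huv]; abel
  have h3 : ‖t • N u - w‖ ^ 2 = t ^ 2 := by
    rw [h2, norm_smul, h.norm_normal v hv, mul_one, Real.norm_eq_abs, sq_abs]
  rw [norm_sub_sq_real, inner_smul_left, norm_smul, h.norm_normal u hu, mul_one,
    Real.norm_eq_abs, sq_abs] at h3
  simp only [conj_trivial] at h3
  have h4 : t * inner ℝ (N u) w ≤ |t| * |inner ℝ (N u) w| := by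
    rw [← abs_mul]; exact le_abs_self _
  have h5 := mul_le_mul_of_nonneg_left h1 (abs_nonneg t)
  have hΔ := h.radius_pos
  rw [← sub_eq_zero, ← hw, ← norm_eq_zero, ← sq_eq_zero_iff]
  apply le_antisymm _ (by positivity)
  by_contra hc; push Not at hc; nlinarith

/-- A point of the closed `σ`-neighbourhood that is close to the normal at `f u` lies below the
parallel curve up to second order. -/
lemma inner_normal_le (h : IsTube f N g Δ) {u : ℝ} (hu : u ∈ Icc (0 : ℝ) 1) (hσΔ : σ < Δ)
    {y : Plane} (hy : infDist y (filament f) ≤ σ) :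
    2 * (Δ - σ) * inner ℝ (N u) (y - (f u + σ • N u)) ≤ ‖y - (f u + σ • N u)‖ ^ 2 := by
  have hΔ := h.radius_pos
  have hgy : g y ≤ σ := (le_abs_self _).trans ((h.abs_eq y).le.trans hy)
  have h1 := (le_abs_self _).trans (h.abs_sub_le (f u + Δ • N u) y)
  rw [h.apply_normal u hu Δ (abs_of_pos hΔ).le, dist_comm, dist_eq_norm] at h1
  set ξ := y - (f u + σ • N u) with hξ
  have heq : y - (f u + Δ • N u) = ξ - (Δ - σ) • N u := by rw [hξ, sub_smul]; abel
  rw [heq] at h1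
  have h2 : (Δ - σ) ^ 2 ≤ ‖ξ - (Δ - σ) • N u‖ ^ 2 := by
    gcongr; linarith
  rw [norm_sub_sq_real, inner_smul_right, norm_smul, h.norm_normal u hu, mul_one,
    Real.norm_eq_abs, sq_abs, real_inner_comm] at h2
  linarith

/-- The centre `y` is within `2R` of `f u + σ N u`, so by `inner_normal_le` its height above that
point is at most `2R² / (Δ - σ) < b`. Above height `b` the distance to `y` increases strictly along
the normal, so moving down enters the open ball. -/
lemma dist_lt_of_lt (h : IsTube f N g Δ) {b s t u : ℝ} (hu : u ∈ Icc (0 : ℝ) 1) (hσΔ : σ < Δ)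
    (hb0 : 0 < b) (hRb : 2 * R ^ 2 < b * (Δ - σ)) {y : Plane}
    (hy : infDist y (filament f) ≤ σ) (hs : σ + b ≤ s) (hst : s < t) (htR : t ≤ σ + R)
    (hyt : dist y (f u + t • N u) ≤ R) : dist y (f u + s • N u) < R := by
  have hn := h.norm_normal u hu
  have key := h.inner_normal_le hu hσΔ hy
  set ξ := y - (f u + σ • N u) with hξ
  have e : ∀ τ, y - (f u + τ • N u) = ξ - (τ - σ) • N u := by
    intro τ; rw [hξ, sub_smul]; abel
  rw [dist_eq_norm, e] at hyt ⊢
  have hξn : ‖ξ‖ ≤ 2 * R := by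
    have h1 : ‖ξ‖ ≤ ‖ξ - (t - σ) • N u‖ + ‖(t - σ) • N u‖ := by
      simpa using norm_add_le (ξ - (t - σ) • N u) ((t - σ) • N u)
    rw [norm_smul, hn, mul_one, Real.norm_of_nonneg (by linarith)] at h1
    linarith
  have hR0 : 0 < R := by linarith
  have hin : inner ℝ (N u) ξ < b := by
    have : ‖ξ‖ ^ 2 ≤ (2 * R) ^ 2 := by gcongr
    by_contra hc; push Not at hc
    nlinarith
  apply lt_of_pow_lt_pow_left₀ 2 hR0.le
  have h2 : ‖ξ - (t - σ) • N u‖ ^ 2 ≤ R ^ 2 := by gcongr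
  rw [norm_sub_sq_real, inner_smul_right, norm_smul, hn, mul_one, Real.norm_eq_abs, sq_abs,
    real_inner_comm] at h2 ⊢
  nlinarith

/-- If the balls cover a neighbourhood that is slightly larger than the closed
`σ`-neighbourhood, the part of the boundary of their union on the positive side is a simple closed
curve, a graph over the filament. -/
lemma isSimpleClosedCurve_positive_frontier (h : IsTube f N g Δ) {b : ℝ} (hσ : 0 < σ)
    (hb0 : 0 < b) (hσR : σ + R < Δ) (hRb : 2 * R ^ 2 < b * (Δ - σ))
    (hY : ∀ i, infDist (Y i) (filament f) ≤ σ)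
    (hcov : ∀ x, infDist x (filament f) ≤ σ + b → ∃ i ∈ Finset.range n, dist (Y i) x < R) :
    IsSimpleClosedCurve (frontier (unionOfBalls Y n R) ∩ {x | 0 < g x}) := by
  have hΔ := h.radius_pos
  set S := unionOfBalls Y n R with hS
  have hR0 : 0 < R := by
    obtain ⟨i, -, hi⟩ := hcov (f 0) (by
      rw [infDist_zero_of_mem (mem_filament (by simp))]; linarith)
    exact dist_nonneg.trans_lt hi
  have hSc : IsClosed S := isClosed_unionOfBalls
  have hupper : ∀ u ∈ Icc (0 : ℝ) 1, ∀ t ∈ Icc 0 Δ, f u + t • N u ∈ S → t ≤ σ + R := by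
    intro u hu t ht hmem
    have h1 := infDist_le_of_mem_unionOfBalls hY hmem
    rwa [← h.abs_eq, h.apply_normal u hu t (by rw [abs_of_nonneg ht.1]; exact ht.2),
      abs_of_nonneg ht.1] at h1
  have hlow : ∀ u ∈ Icc (0 : ℝ) 1, ∀ t, 0 ≤ t → t ≤ σ + b → f u + t • N u ∈ interior S := by
    intro u hu t h0 ht
    apply mem_interior_unionOfBalls
    apply hcov
    refine (infDist_le_dist_of_mem (mem_filament hu)).trans ?_
    simpa [norm_smul, h.norm_normal u hu, abs_of_nonneg h0] using ht
  have hdown : ∀ u ∈ Icc (0 : ℝ) 1, ∀ t ∈ Icc 0 Δ, f u + t • N u ∈ S → ∀ s, 0 ≤ s → s < t →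
      f u + s • N u ∈ interior S := by
    intro u hu t ht hmem s hs0 hst
    rcases le_total s (σ + b) with hsb | hsb
    · exact hlow u hu s hs0 hsb
    · obtain ⟨i, hi, hit⟩ := mem_unionOfBalls.1 hmem
      exact mem_interior_unionOfBalls ⟨i, hi, h.dist_lt_of_lt hu (by linarith) hb0 hRb (hY i) hsb
        hst (hupper u hu t ht hmem) hit⟩
  set I : ℝ → Set ℝ := fun u => {t ∈ Icc 0 Δ | f u + t • N u ∈ S} with hI
  -- The height at which the normal at `f u` leaves the union; by `hdown` everything below it on the
  -- normal is interior.
  set ρ : ℝ → ℝ := fun u => sSup (I u) with hρ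
  have hIc : ∀ u, IsCompact (I u) := fun u =>
    isCompact_Icc.inter_right (hSc.preimage (by fun_prop : Continuous fun t : ℝ => f u + t • N u))
  have hIne : ∀ u ∈ Icc (0 : ℝ) 1, (I u).Nonempty := fun u hu =>
    ⟨0, ⟨le_rfl, hΔ.le⟩, interior_subset (hlow u hu 0 le_rfl (by linarith))⟩
  have hρI : ∀ u ∈ Icc (0 : ℝ) 1, ρ u ∈ I u := fun u hu => (hIc u).sSup_mem (hIne u hu)
  have hρle : ∀ u ∈ Icc (0 : ℝ) 1, ∀ t ∈ Icc 0 Δ, f u + t • N u ∈ S → t ≤ ρ u :=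
    fun u hu t ht hmem => le_csSup (hIc u).bddAbove ⟨ht, hmem⟩
  have hρR : ∀ u ∈ Icc (0 : ℝ) 1, ρ u ≤ σ + R := fun u hu =>
    hupper u hu _ (hρI u hu).1 (hρI u hu).2
  have hρint : ∀ u ∈ Icc (0 : ℝ) 1, ∀ s, 0 ≤ s → s < ρ u → f u + s • N u ∈ interior S :=
    fun u hu => hdown u hu _ (hρI u hu).1 (hρI u hu).2
  have hρpos : ∀ u ∈ Icc (0 : ℝ) 1, 0 < ρ u := by
    intro u hu
    have := hρle u hu (min σ Δ) ⟨by positivity, min_le_right _ _⟩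
      (interior_subset (hlow u hu _ (by positivity) ((min_le_left _ _).trans (by linarith))))
    exact (lt_min hσ hΔ).trans_le this
  have hlt : ∀ u ∈ Icc (0 : ℝ) 1, ρ u < Δ := fun u hu => (hρR u hu).trans_lt hσR
  have hgρ : ∀ u ∈ Icc (0 : ℝ) 1, g (f u + ρ u • N u) = ρ u := fun u hu =>
    h.apply_normal u hu _ (by rw [abs_of_pos (hρpos u hu)]; exact (hlt u hu).le)
  have hcurve : ∀ t : ℝ, ContinuousOn (fun u => f u + t • N u) (Icc 0 1) := fun t =>
    h.continuousOn.add (h.continuousOn_normal.const_smul t)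
  have hρc : ContinuousOn ρ (Icc 0 1) := by
    intro u hu
    -- Lower semicontinuity follows from openness of the interior just below `ρ u`, upper
    -- semicontinuity from openness of the complement above it together with `hdown`.
    refine tendsto_order.2 ⟨fun a ha => ?_, fun a ha => ?_⟩
    · have hm0 : max a 0 < ρ u := max_lt ha (hρpos u hu)
      set t := (max a 0 + ρ u) / 2 with ht
      have ht0 : 0 ≤ t := by have := le_max_right a 0; rw [ht]; linarith
      have hat : a < t := by have := le_max_left a 0; rw [ht]; linarith
      have htρ : t < ρ u := by rw [ht]; linarith
      have hev := (hcurve t u hu).eventually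
        (isOpen_interior.mem_nhds (hρint u hu t ht0 htρ))
      filter_upwards [hev, self_mem_nhdsWithin] with v hv hvI
      exact hat.trans_le (hρle v hvI t ⟨ht0, (htρ.trans (hlt u hu)).le⟩ (interior_subset hv))
    · set t := min a Δ with ht
      have htρ : ρ u < t := lt_min ha (hlt u hu)
      have htI : t ∈ Icc 0 Δ := ⟨(hρpos u hu).le.trans htρ.le, min_le_right _ _⟩
      have hnot : f u + t • N u ∈ Sᶜ := fun hmem =>
        absurd (hρle u hu t htI hmem) (not_le.2 htρ)
      have hev := (hcurve t u hu).eventually (hSc.isOpen_compl.mem_nhds hnot)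
      filter_upwards [hev, self_mem_nhdsWithin] with v hv hvI
      refine lt_of_lt_of_le ?_ (min_le_left a Δ)
      by_contra hc
      push Not at hc
      rcases eq_or_lt_of_le hc with heq | hlt'
      · exact hv (by rw [ht, heq]; exact (hρI v hvI).2)
      · exact hv (interior_subset (hρint v hvI t htI.1 hlt'))
  refine ⟨fun u => f u + ρ u • N u, h.continuousOn.add (hρc.smul h.continuousOn_normal), ?_, ?_, ?_⟩
  · simp only [hρ, hI, h.closed, h.normal_closed]
  · intro u hu v hv huv
    have hu' : u ∈ Icc (0 : ℝ) 1 := ⟨hu.1, hu.2.le⟩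
    have hv' : v ∈ Icc (0 : ℝ) 1 := ⟨hv.1, hv.2.le⟩
    simp only at huv
    have heq : ρ u = ρ v := by rw [← hgρ u hu', huv, hgρ v hv']
    rw [← heq] at huv
    exact h.injOn hu hv (h.eq_of_offset_eq
      (by rw [abs_of_pos (hρpos u hu')]; exact hlt u hu') hu' hv' huv).symm
  · ext x
    constructor
    · rintro ⟨u, hu, rfl⟩
      refine ⟨mem_frontier_unionOfBalls.2 ⟨(hρI u hu).2, fun hint => ?_⟩, ?_⟩
      · have hcont : ContinuousAt (fun t : ℝ => f u + t • N u) (ρ u) := by fun_prop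
        have hev := hcont.eventually (isOpen_interior.mem_nhds hint)
        obtain ⟨t, ht1, ht2, ht3⟩ := ((hev.filter_mono nhdsWithin_le_nhds).and
          (Ioo_mem_nhdsGT (hlt u hu))).exists
        exact absurd (hρle u hu t ⟨(hρpos u hu).le.trans ht2.le, ht3.le⟩ (interior_subset ht1))
          (not_le.2 ht2)
      · change 0 < g _
        rw [hgρ u hu]; exact hρpos u hu
    · rintro ⟨hx, hx0⟩
      have hx0' : 0 < g x := hx0
      obtain ⟨hxS, hxi⟩ := mem_frontier_unionOfBalls.1 hx
      obtain ⟨u, hu, hxu⟩ := h.exists_eq x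
      have hgI : g x ∈ Icc 0 Δ := by
        refine ⟨hx0'.le, ?_⟩
        have := infDist_le_of_mem_unionOfBalls hY hxS
        rw [← h.abs_eq, abs_of_pos hx0'] at this
        linarith
      have hle := hρle u hu (g x) hgI (by rw [← hxu]; exact hxS)
      refine ⟨u, hu, ?_⟩
      rcases eq_or_lt_of_le hle with heq | hlt'
      · simp only [← heq]; exact hxu.symm
      · exact absurd (by rw [hxu]; exact hρint u hu _ hx0'.le hlt') hxi

lemma isTwoCurveSplitting_frontier (h : IsTube f N g Δ) {b : ℝ} (hσ : 0 < σ)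
    (hb0 : 0 < b) (hσR : σ + R < Δ) (hRb : 2 * R ^ 2 < b * (Δ - σ))
    (hY : ∀ i, infDist (Y i) (filament f) ≤ σ)
    (hcov : ∀ x, infDist x (filament f) ≤ σ + b → ∃ i ∈ Finset.range n, dist (Y i) x < R) :
    IsTwoCurveSplitting (frontier (unionOfBalls Y n R))
      (frontier (unionOfBalls Y n R) ∩ {x | 0 < g x})
      (frontier (unionOfBalls Y n R) ∩ {x | g x < 0}) where
  curve₀ := h.isSimpleClosedCurve_positive_frontier hσ hb0 hσR hRb hY hcov
  curve₁ := by
    simpa only [Left.neg_pos_iff] using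
      h.neg.isSimpleClosedCurve_positive_frontier hσ hb0 hσR hRb hY hcov
  disjoint := disjoint_left.2 fun x hx hx' => lt_asymm (show 0 < g x from hx.2) hx'.2
  union := by
    rw [← inter_union_distrib_left]
    refine inter_eq_left.2 fun x hx => ?_
    have : g x ≠ 0 := fun h0 => (mem_frontier_unionOfBalls.1 hx).2
      (mem_interior_unionOfBalls (hcov x (by rw [← h.abs_eq, h0, abs_zero]; linarith)))
    exact this.symm.lt_or_gt

end IsTube

lemma medialConst_pos {σ Δ : ℝ} (hΔ : 0 < Δ) : 0 < medialConst σ Δ := by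
  unfold medialConst; positivity

namespace IsTube

variable {f N : ℝ → Plane} {g : Plane → ℝ} {Δ σ : ℝ}

lemma sign (h : IsTube f N g Δ) {s : ℝ} (hs : s = 1 ∨ s = -1) :
    IsTube f (fun u => s • N u) (fun x => s * g x) Δ := by
  rcases hs with rfl | rfl
  · simpa using h
  · simpa using h.neg

/-- Pull `x` back along its normal to level `c`. This extends a cover of the deep points to points
slightly outside the `σ`-neighbourhood, at the price of larger balls. -/
lemma exists_offset_near (h : IsTube f N g Δ) {c d : ℝ} (hc : 0 ≤ c) (hcd : c ≤ d) {x : Plane}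
    (hx : infDist x (filament f) ≤ d) :
    ∃ y, infDist y (filament f) ≤ c ∧ dist y x ≤ d - c := by
  rcases le_or_gt (infDist x (filament f)) c with hle | hlt
  · exact ⟨x, hle, by rw [dist_self]; linarith⟩
  obtain ⟨u, hu, hxu⟩ := h.exists_eq x
  rw [← h.abs_eq] at hx hlt
  have hg : 0 < |g x| := hc.trans_lt hlt
  have hl : c / |g x| ≤ 1 := (div_le_one hg).2 hlt.le
  refine ⟨f u + (c / |g x| * g x) • N u, ?_, ?_⟩
  · refine (infDist_le_dist_of_mem (mem_filament hu)).trans ?_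
    rw [dist_eq_norm, add_sub_cancel_left, norm_smul, h.norm_normal u hu, mul_one, Real.norm_eq_abs,
      abs_mul, abs_div, abs_abs, abs_of_nonneg hc, div_mul_cancel₀ _ hg.ne']
  · have h1 := h.dist_offset hu (c / |g x| * g x) (g x)
    rw [← hxu] at h1
    have h2 : c / |g x| * g x - g x = -((1 - c / |g x|) * g x) := by ring
    rw [h1, h2, abs_neg, abs_mul, abs_of_nonneg (by linarith), sub_mul, div_mul_cancel₀ _ hg.ne']
    linarith

end IsTube

lemma boundaryCurve_eq {f N : ℝ → Plane} (hN : ∀ u, unitNormal f u = N u) (σ s : ℝ) :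
    boundaryCurve f σ s = offsetCurve f (fun u => s • N u) σ := by
  simp only [boundaryCurve, offsetCurve, hN, smul_smul, mul_comm]

lemma boundaryCurve_neg_eq {f N : ℝ → Plane} (hN : ∀ u, unitNormal f u = N u) (σ s : ℝ) :
    boundaryCurve f σ (-s) = offsetCurve f (fun u => s • N u) (-σ) := by
  simp only [boundaryCurve, offsetCurve, hN, smul_smul, mul_comm, mul_neg]

lemma boundaryPart_eq {f N : ℝ → Plane} {g : Plane → ℝ} {Δ σ s : ℝ} (h : IsTube f N g Δ)
    (hN : ∀ u, unitNormal f u = N u) (hσ : 0 < σ) (hσΔ : σ ≤ Δ) (hs : s = 1 ∨ s = -1)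
    {D : Set Plane} (hD : ∀ x ∈ D, g x ≠ 0) :
    boundaryPart f σ s D = D ∩ {x | 0 < s * g x} := by
  ext x
  have h1 := (h.sign hs).infDist_offsetCurve_le_iff hσ hσΔ x
  rw [← boundaryCurve_eq hN, ← boundaryCurve_neg_eq hN] at h1
  refine and_congr_right fun hx => h1.trans ⟨fun h0 => lt_of_le_of_ne h0 (Ne.symm ?_),
    fun h0 => (show 0 < s * g x from h0).le⟩
  refine mul_ne_zero ?_ (hD x hx)
  rcases hs with rfl | rfl <;> norm_num

/-! ### Assembly and choice of constants. -/

theorem mainTheorem4 (f : ℝ → Plane) (σ : ℝ) (hf : IsClosedFilament f) (hσ : 0 < σ)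
    (hΔ : σ < thickness (filament f)) :
    -- deterministic part
    (∃ C : ℝ, 0 < C ∧ ∀ s : ℝ, s = 1 ∨ s = -1 →
      ∀ (ε : ℝ) (A₀ A₁ Γhat : Set Plane),
        IsCompact A₀ → A₀.Nonempty → IsCompact A₁ → A₁.Nonempty →
        hausdorffDist (boundaryCurve f σ s) A₀ ≤ ε →
        hausdorffDist (boundaryCurve f σ (-s)) A₁ ≤ ε →
        ε < (thickness (filament f) - σ) / 2 →
        IsMedialEstimator A₀ A₁ Γhat →
          (∀ m ∈ Γhat, ∃ x ∈ filament f, ‖m - x‖ ≤ 2 * ε) ∧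
          (∀ x ∈ filament f, ∃ m ∈ Γhat, ‖m - x‖ ≤ C * √ε) ∧
          hausdorffDist Γhat (filament f) ≤ C * √ε) ∧
    -- union-of-balls estimates of the boundary from a random sample
    (∀ (Ω : Type*) [MeasurableSpace Ω] (P : Measure Ω) [IsProbabilityMeasure P]
      (h : ℝ → ℝ) (φ : Plane → ℝ) (β : ℝ) (U : ℕ → Ω → ℝ) (e : ℕ → Ω → Plane),
      IsPositionDensity h → IsNoiseDensity φ σ β → IsFilamentSample P h φ U e →
      (∀ C : ℝ, √(2 / ((1 / 4) * Real.pi)) < C →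
        ∃ K : ℝ, 0 < K ∧ ∀ᵐ ω ∂P, ∀ᶠ n : ℕ in atTop,
          ∀ D : Set Plane,
            D = frontier (unionOfBalls (fun i => f (U i ω) + e i ω) n (C * rate β n)) →
            (∀ A₀ A₁ Γhat : Set Plane, IsTwoCurveSplitting D A₀ A₁ →
              IsMedialEstimator A₀ A₁ Γhat →
              hausdorffDist (filament f) Γhat ≤ K * √(rate β n)) ∧
            (∀ s : ℝ, s = 1 ∨ s = -1 →
              (boundaryPart f σ s D).Nonempty ∧
              ∀ Γhat : Set Plane,
                IsMedialEstimator (boundaryPart f σ s D) (boundaryPart f σ (-s) D) Γhat →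
                hausdorffDist (filament f) Γhat ≤ K * √(rate β n))) ∧
      (∃ C₀ : ℝ, ∀ C : ℝ, C₀ < C → ∀ᵐ ω ∂P, ∀ᶠ n : ℕ in atTop,
        ∃ A₀ A₁ : Set Plane, IsTwoCurveSplitting
          (frontier (unionOfBalls (fun i => f (U i ω) + e i ω) n (C * rate β n))) A₀ A₁)) := by
  have hΔ0 : 0 < thickness (filament f) := hσ.trans hΔ
  obtain ⟨T, ℓ, hcurve, hN⟩ := hf.exists_isThickCurve hΔ0
  obtain ⟨g, ht⟩ := hcurve.exists_isTube
  set Δ := thickness (filament f)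
  refine ⟨⟨medialConst σ Δ, medialConst_pos hΔ0, ?_⟩, ?_⟩
  · intro s hs ε A₀ A₁ Γhat hA₀ hA₀' hA₁ hA₁' h₀ h₁ hε hm
    rw [boundaryCurve_eq hN] at h₀
    rw [boundaryCurve_neg_eq hN] at h₁
    exact (ht.sign hs).medial_bound hσ hΔ hA₀ hA₀' hA₁ hA₁' h₀ h₁ hε hm
  intro Ω _ P _ h φ β U e hh hφ hs
  obtain ⟨M, hM, hcover⟩ := exists_ae_eventually_cover ht hcurve.speed_pos
    (fun u hu v hv => hcurve.norm_sub_le hu hv) hσ hΔ hh hφ hs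
  have hβ := hφ.boundary_behavior.1
  have hdist : ∀ᵐ ω ∂P, ∀ i, infDist (f (U i ω) + e i ω) (filament f) ≤ σ := by
    filter_upwards [hs.ae_mem hφ] with ω hω i
    refine (infDist_le_dist_of_mem (mem_filament (hω i).1)).trans ?_
    simpa using (hω i).2
  have hsmall : ∀ c δ : ℝ, 0 < δ → ∀ᶠ n : ℕ in atTop, c * rate β n < δ := by
    intro c δ hδ
    have h1 := (tendsto_rate hβ).const_mul c
    rw [mul_zero] at h1
    exact h1.eventually (gt_mem_nhds hδ)
  constructor
  · intro C hC
    have hC0 : 0 < C := (Real.sqrt_nonneg _).trans_lt hC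
    -- A small radius factor is compensated by a large depth `K`. Covering with `C / 2` instead of
    -- `C` gives strict inequalities, and the deterministic bound is then used with `ε = (K + 1)
    -- r_n`, which exceeds the radius `C r_n`.
    obtain ⟨K, hK1, hK2⟩ := (((tendsto_rpow_atTop (show 0 < β + 1 / 2 by linarith)).eventually_ge_atTop
      (M / (C / 2) ^ 2)).and (eventually_ge_atTop (2 * C))).exists
    rw [div_le_iff₀ (by positivity)] at hK1
    have hcov := hcover (C / 2) K (by linarith) (by linarith) (by linarith)
    refine ⟨medialConst σ Δ * √(K + 1), mul_pos (medialConst_pos hΔ0)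
      (Real.sqrt_pos.2 (by linarith)), ?_⟩
    filter_upwards [hcov, hdist] with ω hω hY
    filter_upwards [hω, eventually_ge_atTop 2, hsmall (K + 1) σ hσ,
      hsmall (K + 1) ((Δ - σ) / 2) (by linarith)] with n hn hn2 hs1 hs2 D hD
    subst hD
    have hr := rate_pos (β := β) hn2
    have hR0 : 0 < C * rate β n := by positivity
    have hR : C * rate β n < (K + 1) * rate β n := by gcongr; linarith
    have hcovn : ∀ x, infDist x (filament f) ≤ σ - (K + 1) * rate β n →
        ∃ i ∈ Finset.range n, dist (f (U i ω) + e i ω) x < C * rate β n := by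
      intro x hx
      obtain ⟨i, hi, hi'⟩ := hn x (by linarith)
      exact ⟨i, hi, by linarith⟩
    have hrate : medialConst σ Δ * √(K + 1) * √(rate β n) =
        medialConst σ Δ * √((K + 1) * rate β n) := by
      rw [Real.sqrt_mul (by linarith), mul_assoc]
    rw [hrate]
    refine ⟨fun A₀ A₁ Γhat hsp hm => ht.medial_splitting hs1 hs2 hR0 hR hY hcovn hsp hm,
      fun s hs => ?_⟩
    have hD0 : ∀ x ∈ frontier (unionOfBalls (fun i => f (U i ω) + e i ω) n (C * rate β n)),
        g x ≠ 0 := fun x hx => ht.signedDist_ne_zero hs1 hR hY hcovn hx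
    have hs' : -s = 1 ∨ -s = -1 := by
      rcases hs with rfl | rfl <;> simp
    rw [boundaryPart_eq ht hN hσ hΔ.le hs hD0, boundaryPart_eq ht hN hσ hΔ.le hs' hD0]
    simp only [neg_mul, Left.neg_pos_iff]
    exact ⟨((ht.sign hs).positive_frontier hs1 (by linarith) hR0 hR hY hcovn).2.1,
      fun Γhat hm => (ht.sign hs).medial_frontier hs1 hs2 hR0 hR hY hcovn hm⟩
  -- Take `b = (C / 2) r_n`. A point at distance at most `σ + b` is within `(3C / 4) r_n` of a point
  -- at depth `(C / 4) r_n`, which has an observation within `(C / 16) r_n`; the sum is below `C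
  -- r_n`. The threshold makes both `C / 16` and `C / 4` large enough for the covering condition.
  · refine ⟨16 * (M + 1), fun C hC => ?_⟩
    have hC0 : 0 < C := by linarith
    have hρ : 1 ≤ C / 16 := by linarith
    have hK1 : 1 ≤ (C / 4) ^ (β + 1 / 2) := Real.one_le_rpow (by linarith) (by linarith)
    have hM' : M ≤ (C / 16) ^ 2 * (C / 4) ^ (β + 1 / 2) := by
      have h1 : C / 16 ≤ (C / 16) ^ 2 := by nlinarith
      nlinarith
    have hcov := hcover (C / 16) (C / 4) (by linarith) (by linarith) hM'
    filter_upwards [hcov, hdist] with ω hω hY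
    filter_upwards [hω, eventually_ge_atTop 2, hsmall (C / 4) σ hσ,
      hsmall (4 * C) (Δ - σ) (by linarith)] with n hn hn2 hs1 hs2
    have hr := rate_pos (β := β) hn2
    have hCr : 0 < C * rate β n := by positivity
    refine ⟨_, _, ht.isTwoCurveSplitting_frontier (b := C * rate β n / 2) hσ (by positivity)
      (by linarith) (by nlinarith) hY fun x hx => ?_⟩
    obtain ⟨y, hy, hyx⟩ := ht.exists_offset_near (c := σ - C / 4 * rate β n) (by linarith)
      (by linarith) hx
    obtain ⟨i, hi, hi'⟩ := hn y hy
    refine ⟨i, hi, ?_⟩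
    have := dist_triangle (f (U i ω) + e i ω) y x
    linarith
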